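/- Let $\mathcal O_n=\mathbb C\{x_1,\dots,x_n\}$ be the ring of convergent power series (germs at the origin of holomorphic functions on $\mathbb C^n$), with maximal ideal $\mathfrak m$. Elements $f,g\in\mathcal O_n$ are right equivalent, $f\sim g$, if $\phi(f)=g$ for some $\mathbb C$-algebra automorphism $\phi$ of $\mathcal O_n$. For an integer $k\ge 0$, $f\in\mathcal O_n$ is $k$-determined if $f\sim g$ for every $g\in\mathcal O_n$ with the same image as $f$ in $\mathcal O_n/\mathfrak m^{k+1}$. **Theorem.** Let $w_1,\dots,w_n$ be positive integers and let $f\in\mathbb C[x_1,\dots,x_n]$ be quasihomogeneous of isobaric type $(w_1,\dots,w_n;m)$, that is, $w_1a_1+\cdots+w_na_n=m$ for every monomial $x_1^{a_1}\cdots x_n^{a_n}$ appearing in $f$. Assume that $f$ is regular, i.e. $\partial f/\partial x_1,\dots,\partial f/\partial x_n$ is a regular sequence in $\mathbb C[x_1,\dots,x_n]$. Put $k=nm-2\sum_{j=1}^n w_j$, and assume that $m<(k+1)w_i$ for every $i$ (if $k \ge 0$, this says that every monomial of degree $k+1$ has weighted degree greater than $m$; it holds whenever $k\ge m$, and for $n\ge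 1$ and $w_1=\cdots=w_n=1$ it is equivalent to $k\ge m$). Then $k\ge 0$ and $f$ is $k$-determined. -/

import Mathlib

open Filter Topology

/-- The ring `𝒪ₙ = ℂ{x₁, …, xₙ}` of convergent power series, realised as the ring of germs at the
origin of `ℂⁿ` of functions that are the sum of a convergent power series near the origin
(`AnalyticAt ℂ F 0`). -/
def analyticGerms (n : ℕ) : Subring (Germ (𝓝 (0 : Fin n → ℂ)) ℂ) where
  carrier := {φ | ∃ F : (Fin n → ℂ) → ℂ, AnalyticAt ℂ F 0 ∧ Germ.ofFun F = φ}
  mul_mem' := by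
    rintro _ _ ⟨F, hF, rfl⟩ ⟨G, hG, rfl⟩
    exact ⟨F * G, hF.mul hG, rfl⟩
  one_mem' := ⟨1, analyticAt_const, rfl⟩
  add_mem' := by
    rintro _ _ ⟨F, hF, rfl⟩ ⟨G, hG, rfl⟩
    exact ⟨F + G, hF.add hG, rfl⟩
  zero_mem' := ⟨0, analyticAt_const, rfl⟩
  neg_mem' := by
    rintro _ ⟨F, hF, rfl⟩
    exact ⟨-F, hF.neg, rfl⟩

/-- The element of `𝒪ₙ` given by a function analytic at the origin. -/
noncomputable def analyticGerm {n : ℕ} (F : (Fin n → ℂ) → ℂ) (hF : AnalyticAt ℂ F 0) : analyticGerms n :=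
  ⟨Germ.ofFun F, F, hF, rfl⟩

/-- `𝒪ₙ` is a `ℂ`-algebra through the constant germs. -/
noncomputable instance analyticGerms.instAlgebra (n : ℕ) : Algebra ℂ (analyticGerms n) :=
  RingHom.toAlgebra
    { toFun := fun c => analyticGerm (fun _ => c) analyticAt_const
      map_one' := rfl
      map_mul' := fun _ _ => rfl
      map_zero' := rfl
      map_add' := fun _ _ => rfl }

theorem analyticGerms.isUnit_iff {n : ℕ} (φ : analyticGerms n) :
    IsUnit φ ↔ (φ : Germ (𝓝 (0 : Fin n → ℂ)) ℂ).value ≠ 0 := by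
  constructor
  · intro h
    exact (h.map ((Filter.Germ.valueRingHom (x := (0 : Fin n → ℂ)) (E := ℂ)).comp
      (analyticGerms n).subtype)).ne_zero
  · obtain ⟨_, F, hF, rfl⟩ := φ
    intro h
    have h0 : F 0 ≠ 0 := h
    refine IsUnit.of_mul_eq_one (analyticGerm F⁻¹ (hF.inv h0)) (Subtype.ext ?_)
    refine Filter.Germ.coe_eq.mpr ?_
    filter_upwards [hF.continuousAt.eventually_ne h0] with x hx
    exact mul_inv_cancel₀ hx

instance analyticGerms.instIsLocalRing (n : ℕ) : IsLocalRing (analyticGerms n) := by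
  have hnt : Nontrivial (analyticGerms n) := by
    refine ⟨0, 1, fun h => ?_⟩
    have h1 := (analyticGerms.isUnit_iff (1 : analyticGerms n)).mp isUnit_one
    rw [← h] at h1
    exact h1 rfl
  refine IsLocalRing.of_nonunits_add fun a b ha hb => ?_
  simp only [mem_nonunits_iff, analyticGerms.isUnit_iff, not_not] at ha hb ⊢
  have : ((a + b : analyticGerms n) : Germ (𝓝 (0 : Fin n → ℂ)) ℂ).value =
      (a : Germ (𝓝 (0 : Fin n → ℂ)) ℂ).value + (b : Germ (𝓝 (0 : Fin n → ℂ)) ℂ).value :=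
    map_add (Filter.Germ.valueRingHom (x := (0 : Fin n → ℂ)) (E := ℂ)) _ _
  rw [this, ha, hb, add_zero]

/-- The inclusion `ℂ[x₁, …, xₙ] → 𝒪ₙ`, sending a polynomial to the germ of its function. -/
noncomputable def MvPolynomial.toAnalyticGerm {n : ℕ} (f : MvPolynomial (Fin n) ℂ) : analyticGerms n :=
  analyticGerm (fun x => MvPolynomial.eval x f) (AnalyticOnNhd.eval_mvPolynomial f 0 trivial)

/-- Right equivalence: some `ℂ`-algebra automorphism of `𝒪ₙ` takes `f` to `g`. -/
def RightEquivalent {n : ℕ} (f g : analyticGerms n) : Prop :=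
  ∃ φ : analyticGerms n ≃ₐ[ℂ] analyticGerms n, φ f = g

/-- The `k`-truncation of `f`: its image in `𝒪ₙ / 𝔪ᵏ⁺¹`. -/
noncomputable def truncation {n : ℕ} (k : ℕ) (f : analyticGerms n) :
    analyticGerms n ⧸ IsLocalRing.maximalIdeal (analyticGerms n) ^ (k + 1) :=
  Ideal.Quotient.mk _ f

/-- `f` is `k`-determined: every `g` with the same `k`-truncation is right equivalent to `f`. -/
def IsDetermined {n : ℕ} (k : ℕ) (f : analyticGerms n) : Prop :=
  ∀ g : analyticGerms n, truncation k f = truncation k g → RightEquivalent f g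

/-- `f` is regular: its partial derivatives form a regular sequence. -/
def IsRegularPolynomial {n : ℕ} (f : MvPolynomial (Fin n) ℂ) : Prop :=
  RingTheory.Sequence.IsRegular (MvPolynomial (Fin n) ℂ)
    (List.ofFn fun i : Fin n => MvPolynomial.pderiv i f)

/-!
Let `J` be the Jacobian ideal of `f`, `∂ᵢ f` being weighted homogeneous of degree `m - wᵢ`, and let
`g = f + h` with `h ∈ 𝔪ᵏ⁺¹`. The hypothesis on the weights says that `h` has weighted order greater
than `m`, and its weighted order is also greater than `k`.

*Hilbert series.* Dividing by a homogeneous nonzerodivisor of degree `d` multiplies the Hilbert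
series of the quotient by `1 - X ^ d`, so the series `H` of `ℂ[x] / J` satisfies
`H * ∏ (1 - X ^ wᵢ) = ∏ (1 - X ^ (m - wᵢ))`. After cancelling `(1 - X) ^ n` all coefficients are
nonnegative and the right-hand side is a polynomial, so that `H` has degree at most
`∑ (m - 2 wᵢ) = k`: every homogeneous polynomial of weighted degree greater than `k` lies in `J`
(`mem_span_range_of_isWeightedHomogeneous`). Since the ideal of germs of weighted order at least `d`
is generated by monomials, the germs of weighted order `d > k` are combinations `∑ aᵢ ∂ᵢ f` with
`aᵢ` of weighted order at least `wᵢ + d - m` (`exists_eq_sum_mul_pderiv`).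

*Raising the order.* If `h = ∑ aᵢ ∂ᵢ f` has weighted order `d > max k m`, the substitution
`xᵢ ↦ xᵢ - aᵢ` is an automorphism of `𝒪ₙ`, its linear part being unipotent, and Taylor expansion
shows that it takes `f + h` to `f + h'` with `h'` of weighted order at least `d + 1`
(`exists_algEquiv_add_eq_add`).

*Conclusion.* After finitely many steps the perturbation lies in `𝔪 J²`, say `h = ∑ bᵢⱼ ∂ᵢf ∂ⱼf`. The
implicit function theorem provides an analytic matrix `Y` with `Y(0) = 0` and
`f (x + Y(x) ∇f(x)) = f(x) + h(x)` (`exists_analyticAt_eval_add_eq`), and `x ↦ x + Y(x) ∇f(x)` is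
tangent to the identity. The passage from analytic maps to automorphisms of `𝒪ₙ` rests on the inverse
function theorem and on Hadamard's lemma, by which `𝔪` is generated by the coordinates.
-/

/-! ### Hilbert series of quotients by homogeneous ideals -/

section HilbertSeries

open MvPolynomial

variable {n : ℕ} {K : Type*} [Field K] (w : Fin n → ℕ)

theorem weightedHomogeneousComponent_add_mul {d : ℕ} {g : MvPolynomial (Fin n) K}
    (hg : g.IsWeightedHomogeneous w d) (r : MvPolynomial (Fin n) K) (c : ℕ) :
    weightedHomogeneousComponent w (d + c) (g * r) =
      g * weightedHomogeneousComponent w c r := by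
  induction r using MvPolynomial.induction_on' with
  | monomial a b =>
    have hm := isWeightedHomogeneous_monomial w a b rfl
    rw [weightedHomogeneousComponent_of_mem (hg.mul hm), weightedHomogeneousComponent_of_mem hm]
    by_cases hc : c = Finsupp.weight w a <;> simp [hc]
  | add p q hp hq => rw [mul_add, map_add, map_add, mul_add, hp, hq]

theorem weightedHomogeneousComponent_mul_of_lt {d : ℕ} {g : MvPolynomial (Fin n) K}
    (hg : g.IsWeightedHomogeneous w d) (r : MvPolynomial (Fin n) K) {c : ℕ} (hc : c < d) :
    weightedHomogeneousComponent w c (g * r) = 0 := by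
  induction r using MvPolynomial.induction_on' with
  | monomial a b =>
    rw [weightedHomogeneousComponent_of_mem (hg.mul (isWeightedHomogeneous_monomial w a b rfl)),
      if_neg]
    lia
  | add p q hp hq => rw [mul_add, map_add, hp, hq, add_zero]

/-- Homogeneity of an ideal, stated through the components of its elements. -/
def IsComponentClosed (I : Ideal (MvPolynomial (Fin n) K)) : Prop :=
  ∀ p ∈ I, ∀ c, weightedHomogeneousComponent w c p ∈ I

/-- The part of weighted degree `c` of an ideal, as a linear subspace. -/
noncomputable def gradedPiece (I : Ideal (MvPolynomial (Fin n) K)) (c : ℕ) :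
    Submodule K (MvPolynomial (Fin n) K) :=
  weightedHomogeneousSubmodule K w c ⊓ I.restrictScalars K

variable {w}

theorem finiteDimensional_weightedHomogeneousSubmodule (hw : ∀ i, 0 < w i) (c : ℕ) :
    FiniteDimensional K (weightedHomogeneousSubmodule K w c) :=
  Module.Finite.iff_fg.mpr (weightedHomogeneousSubmodule_fg K w (fun i => (hw i).ne') c)

theorem gradedPiece_le (I : Ideal (MvPolynomial (Fin n) K)) (c : ℕ) :
    gradedPiece w I c ≤ weightedHomogeneousSubmodule K w c := inf_le_left

theorem finiteDimensional_gradedPiece (hw : ∀ i, 0 < w i) (I : Ideal (MvPolynomial (Fin n) K))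
    (c : ℕ) : FiniteDimensional K (gradedPiece w I c) :=
  have := finiteDimensional_weightedHomogeneousSubmodule (K := K) hw c
  Submodule.finiteDimensional_of_le (gradedPiece_le I c)

variable (w) in
/-- The Hilbert series of the quotient of the polynomial ring by `I`: its `c`-th coefficient is the
codimension of the part of weighted degree `c` of `I`. -/
noncomputable def quotientHilbertSeries (I : Ideal (MvPolynomial (Fin n) K)) : PowerSeries ℤ :=
  PowerSeries.mk fun c => (Module.finrank K (weightedHomogeneousSubmodule K w c) : ℤ) -
    Module.finrank K (gradedPiece w I c)

theorem IsComponentClosed.sup_span_singleton {I : Ideal (MvPolynomial (Fin n) K)}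
    (hI : IsComponentClosed w I) {d : ℕ} {g : MvPolynomial (Fin n) K}
    (hg : g.IsWeightedHomogeneous w d) : IsComponentClosed w (I ⊔ Ideal.span {g}) := by
  intro p hp c
  obtain ⟨a, ha, b, hb, rfl⟩ := Submodule.mem_sup.mp hp
  obtain ⟨r, rfl⟩ := Ideal.mem_span_singleton.mp hb
  rw [map_add]
  refine add_mem (Ideal.mem_sup_left (hI a ha c)) (Ideal.mem_sup_right ?_)
  rcases lt_or_ge c d with h | h
  · rw [weightedHomogeneousComponent_mul_of_lt w hg r h]
    exact zero_mem _
  · obtain ⟨e, rfl⟩ := Nat.exists_eq_add_of_le h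
    rw [weightedHomogeneousComponent_add_mul w hg r e]
    exact Ideal.mul_mem_right _ _ (Ideal.mem_span_singleton_self g)

theorem gradedPiece_sup_of_lt {I : Ideal (MvPolynomial (Fin n) K)}
    (hI : IsComponentClosed w I) {d : ℕ} {g : MvPolynomial (Fin n) K}
    (hg : g.IsWeightedHomogeneous w d) {c : ℕ} (hc : c < d) :
    gradedPiece w (I ⊔ Ideal.span {g}) c = gradedPiece w I c := by
  refine le_antisymm (fun p hp => ?_) (inf_le_inf_left _ fun p hp => Ideal.mem_sup_left hp)
  obtain ⟨hpc, hp⟩ := hp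
  refine ⟨hpc, ?_⟩
  obtain ⟨a, ha, b, hb, rfl⟩ := Submodule.mem_sup.mp hp
  obtain ⟨r, rfl⟩ := Ideal.mem_span_singleton.mp hb
  have h := weightedHomogeneousComponent_eq_self hpc
  rw [map_add, weightedHomogeneousComponent_mul_of_lt w hg r hc, add_zero] at h
  rw [← h]
  exact hI a ha c

theorem gradedPiece_sup_add {I : Ideal (MvPolynomial (Fin n) K)}
    (hI : IsComponentClosed w I) {d : ℕ} {g : MvPolynomial (Fin n) K}
    (hg : g.IsWeightedHomogeneous w d) (c : ℕ) :
    gradedPiece w (I ⊔ Ideal.span {g}) (d + c) = gradedPiece w I (d + c) ⊔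
      (weightedHomogeneousSubmodule K w c).map (LinearMap.mulLeft K g) := by
  refine le_antisymm (fun p hp => ?_)
    (sup_le (inf_le_inf_left _ fun p hp => Ideal.mem_sup_left hp) ?_)
  · obtain ⟨hpc, hp⟩ := hp
    obtain ⟨a, ha, b, hb, rfl⟩ := Submodule.mem_sup.mp hp
    obtain ⟨r, rfl⟩ := Ideal.mem_span_singleton.mp hb
    have h := weightedHomogeneousComponent_eq_self hpc
    rw [map_add, weightedHomogeneousComponent_add_mul w hg r c] at h
    rw [← h]
    exact Submodule.add_mem_sup ⟨weightedHomogeneousComponent_mem w a _, hI a ha _⟩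
      ⟨_, weightedHomogeneousComponent_mem w r c, rfl⟩
  · rintro _ ⟨r, hr, rfl⟩
    exact ⟨hg.mul hr, Ideal.mem_sup_right
      (Ideal.mul_mem_right _ _ (Ideal.mem_span_singleton_self g))⟩

theorem gradedPiece_inf_map_mulLeft {I : Ideal (MvPolynomial (Fin n) K)}
    {d : ℕ} {g : MvPolynomial (Fin n) K} (hg : g.IsWeightedHomogeneous w d)
    (hreg : ∀ r, g * r ∈ I → r ∈ I) (c : ℕ) :
    gradedPiece w I (d + c) ⊓ (weightedHomogeneousSubmodule K w c).map (LinearMap.mulLeft K g) =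
      (gradedPiece w I c).map (LinearMap.mulLeft K g) := by
  ext p
  constructor
  · rintro ⟨hp, r, hr, rfl⟩
    exact ⟨r, ⟨hr, hreg r hp.2⟩, rfl⟩
  · rintro ⟨r, hr, rfl⟩
    exact ⟨⟨hg.mul hr.1, I.mul_mem_left _ hr.2⟩, r, hr.1, rfl⟩

/-- Adding to `I` a homogeneous element of degree `d` that is a nonzerodivisor modulo `I` multiplies
the Hilbert series of the quotient by `1 - X ^ d`. -/
theorem quotientHilbertSeries_sup_span_singleton (hw : ∀ i, 0 < w i)
    {I : Ideal (MvPolynomial (Fin n) K)} (hI : IsComponentClosed w I) {d : ℕ}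
    {g : MvPolynomial (Fin n) K} (hg : g.IsWeightedHomogeneous w d) (hg0 : g ≠ 0)
    (hreg : ∀ r, g * r ∈ I → r ∈ I) :
    quotientHilbertSeries w (I ⊔ Ideal.span {g}) =
      quotientHilbertSeries w I * (1 - PowerSeries.X ^ d) := by
  ext c
  rw [mul_sub, mul_one, map_sub, PowerSeries.coeff_mul_X_pow']
  simp only [quotientHilbertSeries, PowerSeries.coeff_mk]
  rcases lt_or_ge c d with h | h
  · rw [if_neg (by lia), gradedPiece_sup_of_lt hI hg h, sub_zero]
  · obtain ⟨c, rfl⟩ := Nat.exists_eq_add_of_le h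
    rw [if_pos h, Nat.add_sub_cancel_left, gradedPiece_sup_add hI hg]
    have := finiteDimensional_gradedPiece hw I (d + c)
    have := finiteDimensional_weightedHomogeneousSubmodule (K := K) hw c
    have h := Submodule.finrank_sup_add_finrank_inf_eq (gradedPiece w I (d + c))
      ((weightedHomogeneousSubmodule K w c).map (LinearMap.mulLeft K g))
    have hinj : Function.Injective (LinearMap.mulLeft K g) := fun a b hab =>
      mul_left_cancel₀ hg0 hab
    rw [gradedPiece_inf_map_mulLeft hg hreg,
      ← LinearEquiv.finrank_eq (Submodule.equivMapOfInjective _ hinj _),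
      ← LinearEquiv.finrank_eq (Submodule.equivMapOfInjective _ hinj _)] at h
    lia

theorem finrank_weightedHomogeneousSubmodule (c : ℕ) :
    Module.finrank K (weightedHomogeneousSubmodule K w c) =
      Nat.card {a : Fin n →₀ ℕ // Finsupp.weight w a = c} := by
  rw [weightedHomogeneousSubmodule_eq_finsupp_supported]
  exact Module.finrank_eq_nat_card_basis
    (basisRestrictSupport K {d : Fin n →₀ ℕ | Finsupp.weight w d = c})

theorem isComponentClosed_bot : IsComponentClosed w (⊥ : Ideal (MvPolynomial (Fin n) K)) := by
  intro p hp c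
  rw [Ideal.mem_bot.mp hp, map_zero]
  exact zero_mem _

theorem quotientHilbertSeries_bot_eq_prod (hw : ∀ i, 0 < w i) :
    quotientHilbertSeries w (⊥ : Ideal (MvPolynomial (Fin n) K)) =
      ∏ i, PowerSeries.mk fun j => if w i ∣ j then (1 : ℤ) else 0 := by
  ext c
  have hbot : gradedPiece w (⊥ : Ideal (MvPolynomial (Fin n) K)) c = ⊥ := by
    rw [eq_bot_iff]
    exact fun p hp => hp.2
  rw [PowerSeries.coeff_prod]
  simp only [quotientHilbertSeries, PowerSeries.coeff_mk, Finset.prod_ite_zero,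
    Finset.prod_const_one]
  rw [hbot, finrank_bot, Nat.cast_zero, sub_zero, Finset.sum_boole, Nat.cast_inj,
    finrank_weightedHomogeneousSubmodule, ← Nat.card_eq_finsetCard]
  -- The exponent `a` corresponds to the splitting `c = ∑ i, w i * a i` of `c` into multiples of the
  -- weights.
  refine Nat.card_eq_of_bijective
    (fun a => ⟨Finsupp.equivFunOnFinite.symm fun i => w i * a.1 i, ?_⟩) ⟨?_, ?_⟩
  · obtain ⟨a, rfl⟩ := a
    simp [Finset.mem_finsuppAntidiag, Finsupp.weight_apply, Finsupp.sum_fintype, mul_comm]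
  · intro a b hab
    ext i
    have h := DFunLike.congr_fun (Subtype.ext_iff.mp hab) i
    exact Nat.eq_of_mul_eq_mul_left (hw i) h
  · rintro ⟨l, hl⟩
    simp only [Finset.mem_filter, Finset.mem_finsuppAntidiag, Finset.mem_univ, true_implies] at hl
    choose a ha using hl.2
    refine ⟨⟨Finsupp.equivFunOnFinite.symm a, ?_⟩, Subtype.ext (Finsupp.ext fun i => ?_)⟩
    · rw [← hl.1.1]
      simp [Finsupp.weight_apply, Finsupp.sum_fintype, ha, mul_comm]
    · simp [ha]

theorem quotientHilbertSeries_bot_mul (hw : ∀ i, 0 < w i) :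
    quotientHilbertSeries w (⊥ : Ideal (MvPolynomial (Fin n) K)) *
      ∏ i, (1 - PowerSeries.X ^ w i) = 1 := by
  rw [quotientHilbertSeries_bot_eq_prod hw, ← Finset.prod_mul_distrib]
  refine Finset.prod_eq_one fun i _ => ?_
  ext c
  rw [mul_sub, mul_one, map_sub, PowerSeries.coeff_mul_X_pow', PowerSeries.coeff_one]
  simp only [PowerSeries.coeff_mk]
  have := hw i
  rcases lt_or_ge c (w i) with h | h
  · rw [if_neg (not_le.mpr h), sub_zero]
    refine if_congr ⟨fun hd => Nat.eq_zero_of_dvd_of_lt hd h, ?_⟩ rfl rfl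
    rintro rfl
    exact dvd_zero _
  · rw [if_pos h, if_neg (by lia : c ≠ 0), sub_eq_zero]
    obtain ⟨e, rfl⟩ := Nat.exists_eq_add_of_le h
    rw [Nat.add_sub_cancel_left]
    exact if_congr (Nat.dvd_add_right (dvd_refl _)) rfl rfl

end HilbertSeries

/-! ### Quotients by homogeneous regular sequences -/

section RegularSequence

open MvPolynomial

variable {n : ℕ} {K : Type*} [Field K] {w : Fin n → ℕ}

/-- The Hilbert series of the quotient by the first `i` terms of a regular sequence of homogeneous
polynomials. -/
theorem quotientHilbertSeries_ofList_take (hw : ∀ i, 0 < w i) {l : ℕ}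
    {g : Fin l → MvPolynomial (Fin n) K} {d : Fin l → ℕ}
    (hg : ∀ i, (g i).IsWeightedHomogeneous w (d i)) (hg0 : ∀ i, g i ≠ 0)
    (hreg : RingTheory.Sequence.IsWeaklyRegular (MvPolynomial (Fin n) K) (List.ofFn g))
    (i : ℕ) (hi : i ≤ l) :
    IsComponentClosed w (Ideal.ofList ((List.ofFn g).take i)) ∧
    quotientHilbertSeries w (Ideal.ofList ((List.ofFn g).take i)) =
      quotientHilbertSeries w (⊥ : Ideal (MvPolynomial (Fin n) K)) *
        ((List.ofFn fun j => (1 : PowerSeries ℤ) - PowerSeries.X ^ d j).take i).prod := by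
  induction i with
  | zero => simpa using isComponentClosed_bot
  | succ i ih =>
    obtain ⟨hcl, hser⟩ := ih (by lia)
    have hlen : i < (List.ofFn g).length := by simpa using hi
    have hlen' : i < (List.ofFn fun j => (1 : PowerSeries ℤ) - PowerSeries.X ^ d j).length := by
      simpa using hi
    have hgi : (List.ofFn g)[i] = g ⟨i, hi⟩ := by simp
    have hr := hreg.regular_mod_prev i hlen
    rw [hgi] at hr
    rw [← List.take_append_getElem hlen, ← List.take_append_getElem hlen', Ideal.ofList_append,
      Ideal.ofList_singleton, hgi, List.prod_append, ← mul_assoc, ← hser]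
    refine ⟨hcl.sup_span_singleton (hg _), ?_⟩
    rw [quotientHilbertSeries_sup_span_singleton hw hcl (hg _) (hg0 _)]
    · simp
    · intro r h
      have htop : (Ideal.ofList ((List.ofFn g).take i) • ⊤ :
          Submodule (MvPolynomial (Fin n) K) (MvPolynomial (Fin n) K)) =
          Ideal.ofList ((List.ofFn g).take i) := by simp
      rw [htop] at hr
      rw [← Ideal.Quotient.eq_zero_iff_mem]
      refine hr.right_eq_zero_of_smul ?_
      exact Ideal.Quotient.eq_zero_iff_mem.mpr h

theorem quotientHilbertSeries_mul_prod (hw : ∀ i, 0 < w i) {l : ℕ}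
    {g : Fin l → MvPolynomial (Fin n) K} {d : Fin l → ℕ}
    (hg : ∀ i, (g i).IsWeightedHomogeneous w (d i)) (hg0 : ∀ i, g i ≠ 0)
    (hreg : RingTheory.Sequence.IsWeaklyRegular (MvPolynomial (Fin n) K) (List.ofFn g)) :
    quotientHilbertSeries w (Ideal.span (Set.range g)) * ∏ i, (1 - PowerSeries.X ^ w i) =
      ∏ i, (1 - PowerSeries.X ^ d i) := by
  have h := (quotientHilbertSeries_ofList_take hw hg hg0 hreg l le_rfl).2
  rw [List.take_of_length_le (by simp), List.take_of_length_le (by simp), List.prod_ofFn] at h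
  have hspan : Ideal.ofList (List.ofFn g) = Ideal.span (Set.range g) := by
    rw [Ideal.ofList]
    congr 1
    ext p
    simp [List.mem_ofFn]
  rw [← hspan, h, mul_right_comm, quotientHilbertSeries_bot_mul hw, one_mul]

theorem PowerSeries.coeff_mul_nonneg {p q : PowerSeries ℤ} (hp : ∀ j, 0 ≤ coeff j p)
    (hq : ∀ j, 0 ≤ coeff j q) (j : ℕ) : 0 ≤ coeff j (p * q) := by
  rw [coeff_mul]
  exact Finset.sum_nonneg fun x _ => mul_nonneg (hp _) (hq _)

theorem PowerSeries.coeff_mul_coeff_le {p q : PowerSeries ℤ} (hp : ∀ j, 0 ≤ coeff j p)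
    (hq : ∀ j, 0 ≤ coeff j q) (i j : ℕ) : coeff i p * coeff j q ≤ coeff (i + j) (p * q) := by
  rw [coeff_mul]
  exact Finset.single_le_sum (f := fun x : ℕ × ℕ => coeff x.1 p * coeff x.2 q)
    (fun x _ => mul_nonneg (hp _) (hq _)) (a := (i, j)) (by simp)

/-- The polynomial `1 + X + ⋯ + X ^ (d - 1)`, as a power series. -/
noncomputable def geomSeries (d : ℕ) : PowerSeries ℤ := ∑ j ∈ Finset.range d, PowerSeries.X ^ j

theorem coeff_geomSeries (d c : ℕ) :
    PowerSeries.coeff c (geomSeries d) = if c < d then 1 else 0 := by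
  simp [geomSeries, PowerSeries.coeff_X_pow]

theorem one_sub_X_mul_geomSeries (d : ℕ) :
    (1 - PowerSeries.X) * geomSeries d = 1 - PowerSeries.X ^ d :=
  mul_neg_geom_sum _ _

theorem coeff_prod_geomSeries_pos {ι : Type*} (s : Finset ι) {w : ι → ℕ} (hw : ∀ i, 0 < w i) :
    (∀ j, 0 ≤ PowerSeries.coeff j (∏ i ∈ s, geomSeries (w i))) ∧
      1 ≤ PowerSeries.coeff (∑ i ∈ s, (w i - 1)) (∏ i ∈ s, geomSeries (w i)) := by
  classical
  induction s using Finset.induction_on with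
  | empty =>
    refine ⟨fun j => ?_, by simp⟩
    rw [Finset.prod_empty, PowerSeries.coeff_one]
    split_ifs <;> simp
  | insert a s ha ih =>
    have h0 : ∀ j, 0 ≤ PowerSeries.coeff j (geomSeries (w a)) := fun j => by
      rw [coeff_geomSeries]
      split_ifs <;> simp
    rw [Finset.prod_insert ha, Finset.sum_insert ha]
    refine ⟨PowerSeries.coeff_mul_nonneg h0 ih.1,
      le_trans ?_ (PowerSeries.coeff_mul_coeff_le h0 ih.1 _ _)⟩
    have := hw a
    rw [coeff_geomSeries, if_pos (by lia), one_mul]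
    exact ih.2

theorem coeff_prod_geomSeries_eq_zero {ι : Type*} (s : Finset ι) (d : ι → ℕ) {c : ℕ}
    (hc : ∑ i ∈ s, d i < c + s.card) :
    PowerSeries.coeff c (∏ i ∈ s, geomSeries (d i)) = 0 := by
  classical
  induction s using Finset.induction_on generalizing c with
  | empty =>
    have : c ≠ 0 := by rintro rfl; simp at hc
    simp [PowerSeries.coeff_one, this]
  | insert a s ha ih =>
    rw [Finset.sum_insert ha, Finset.card_insert_of_notMem ha] at hc
    rw [Finset.prod_insert ha, PowerSeries.coeff_mul]
    refine Finset.sum_eq_zero fun x hx => ?_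
    rw [Finset.HasAntidiagonal.mem_antidiagonal] at hx
    rw [coeff_geomSeries]
    split_ifs with h
    · rw [ih (by lia), mul_zero]
    · rw [zero_mul]

/-- Homogeneous polynomials of weighted degree above `∑ (d i - w i)` lie in the ideal of a regular
sequence `g` of length `n` of homogeneous polynomials of degrees `d i`: the Hilbert series `H` of the
quotient satisfies `H * ∏ (1 + ⋯ + X ^ (w i - 1)) = ∏ (1 + ⋯ + X ^ (d i - 1))`, and all coefficients
in it are nonnegative, so `H` has degree at most `∑ (d i - 1) - ∑ (w i - 1)`. -/
theorem mem_span_range_of_isWeightedHomogeneous (hw : ∀ i, 0 < w i)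
    {g : Fin n → MvPolynomial (Fin n) K} {d : Fin n → ℕ}
    (hg : ∀ i, (g i).IsWeightedHomogeneous w (d i)) (hg0 : ∀ i, g i ≠ 0)
    (hreg : RingTheory.Sequence.IsWeaklyRegular (MvPolynomial (Fin n) K) (List.ofFn g))
    {c : ℕ} (hc : ∑ i, d i < c + ∑ i, w i) {p : MvPolynomial (Fin n) K}
    (hp : p.IsWeightedHomogeneous w c) : p ∈ Ideal.span (Set.range g) := by
  set I := Ideal.span (Set.range g)
  have hfin := finiteDimensional_weightedHomogeneousSubmodule (K := K) hw
  have hnonneg : ∀ j, 0 ≤ PowerSeries.coeff j (quotientHilbertSeries w I) := fun j => by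
    have := Submodule.finrank_mono (gradedPiece_le (w := w) I j)
    rw [quotientHilbertSeries, PowerSeries.coeff_mk]
    lia
  have hmul : quotientHilbertSeries w I * ∏ i, geomSeries (w i) = ∏ i, geomSeries (d i) := by
    have h := quotientHilbertSeries_mul_prod hw hg hg0 hreg
    simp only [← one_sub_X_mul_geomSeries, Finset.prod_mul_distrib, Finset.prod_const] at h
    rw [mul_left_comm] at h
    refine mul_left_cancel₀ (pow_ne_zero _ ?_) h
    intro h0
    simpa using congrArg (PowerSeries.coeff 0) h0
  have hsum : ∑ i, (w i - 1) + n = ∑ i, w i := by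
    have : ∑ i, w i = ∑ i, ((w i - 1) + 1) :=
      Finset.sum_congr rfl fun i _ => (Nat.sub_add_cancel (hw i)).symm
    rw [this, Finset.sum_add_distrib]
    simp
  obtain ⟨hQ, hQ1⟩ := coeff_prod_geomSeries_pos Finset.univ hw
  have hle := PowerSeries.coeff_mul_coeff_le hnonneg hQ c (∑ i, (w i - 1))
  have hdeg : ∑ i, d i < c + ∑ i, (w i - 1) + (Finset.univ : Finset (Fin n)).card := by
    rw [Finset.card_univ, Fintype.card_fin, add_assoc, hsum]
    exact hc
  rw [hmul, coeff_prod_geomSeries_eq_zero _ _ hdeg] at hle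
  have hzero : PowerSeries.coeff c (quotientHilbertSeries w I) = 0 := by
    nlinarith [hnonneg c]
  rw [quotientHilbertSeries, PowerSeries.coeff_mk, sub_eq_zero, Nat.cast_inj] at hzero
  have heq := Submodule.eq_of_le_of_finrank_eq (gradedPiece_le (w := w) I c) hzero.symm
  have hp' : p ∈ weightedHomogeneousSubmodule K w c := hp
  rw [← heq] at hp'
  exact hp'.2

/-- The coefficients expressing a homogeneous element of an ideal through homogeneous generators can
be chosen homogeneous. -/
theorem exists_eq_sum_mul_isWeightedHomogeneous {l : ℕ} {g : Fin l → MvPolynomial (Fin n) K}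
    {d : Fin l → ℕ} (hg : ∀ i, (g i).IsWeightedHomogeneous w (d i)) {c : ℕ}
    {p : MvPolynomial (Fin n) K} (hp : p.IsWeightedHomogeneous w c)
    (hmem : p ∈ Ideal.span (Set.range g)) (hd : ∀ i, d i ≤ c) :
    ∃ b : Fin l → MvPolynomial (Fin n) K,
      (∀ i, (b i).IsWeightedHomogeneous w (c - d i)) ∧ p = ∑ i, b i * g i := by
  obtain ⟨r, hr⟩ := Ideal.mem_span_range_iff_exists_fun.mp hmem
  refine ⟨fun i => weightedHomogeneousComponent w (c - d i) (r i),
    fun i => weightedHomogeneousComponent_mem _ _ _, ?_⟩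
  rw [← weightedHomogeneousComponent_eq_self hp, ← hr, map_sum]
  refine Finset.sum_congr rfl fun i _ => ?_
  rw [mul_comm, mul_comm _ (g i), ← weightedHomogeneousComponent_add_mul w (hg i)]
  rw [Nat.add_sub_cancel' (hd i)]

end RegularSequence

/-! ### Germs of analytic functions and their automorphisms -/

section Germs

variable {n : ℕ}

/-- Hadamard's lemma for analytic functions of several variables. -/
theorem AnalyticAt.exists_eq_add_sum_mul {F : (Fin n → ℂ) → ℂ} (hF : AnalyticAt ℂ F 0) :
    ∃ G : Fin n → (Fin n → ℂ) → ℂ, (∀ i, AnalyticAt ℂ (G i) 0) ∧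
      ∀ᶠ x in 𝓝 0, F x = F 0 + ∑ i, x i * G i x := by
  obtain ⟨p, r, hp⟩ := hF
  -- `G x` is the sum of the shifted series, a linear form depending analytically on `x`, and
  -- `F x = F 0 + G x x`.
  have hrad : 0 < p.shift.radius := by
    rw [FormalMultilinearSeries.radius_shift]
    exact hp.r_pos.trans_le hp.r_le
  have hq := p.shift.hasFPowerSeriesOnBall hrad
  have hu := hq.unshift (z := F 0)
  have hps : p.shift.unshift (F 0) = p := by
    ext k v
    cases k with
    | zero => simpa [FormalMultilinearSeries.unshift] using (hp.coeff_zero v).symm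
    | succ k => simp [FormalMultilinearSeries.unshift, FormalMultilinearSeries.shift]
  rw [hps] at hu
  refine ⟨fun i x => p.shift.sum x (Pi.single i 1), fun i => ?_, ?_⟩
  · exact ((ContinuousLinearMap.apply ℂ ℂ (Pi.single i (1 : ℂ) : Fin n → ℂ)).analyticAt _).comp
      hq.analyticAt
  · obtain ⟨ε, hε, hε'⟩ : ∃ ε, 0 < ε ∧ ε ≤ min r p.shift.radius :=
      ⟨_, lt_min hp.r_pos hrad, le_rfl⟩
    have heq := (hp.mono hε (hε'.trans (min_le_left _ _))).unique
      (hu.mono hε (hε'.trans (min_le_right _ _)))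
    filter_upwards [Metric.eball_mem_nhds (0 : Fin n → ℂ) hε] with x hx
    refine (heq hx).trans ?_
    simp only [sub_zero]
    congr 1
    conv_lhs => rw [pi_eq_sum_univ' x, map_sum]
    refine Finset.sum_congr rfl fun i _ => ?_
    rw [map_smul, smul_eq_mul]
    rw [← pi_eq_sum_univ' x]

/-- The value at the origin. -/
noncomputable def germValue (n : ℕ) : analyticGerms n →+* ℂ :=
  (Filter.Germ.valueRingHom (x := (0 : Fin n → ℂ)) (E := ℂ)).comp (analyticGerms n).subtype

theorem germValue_analyticGerm {F : (Fin n → ℂ) → ℂ} (hF : AnalyticAt ℂ F 0) :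
    germValue n (analyticGerm F hF) = F 0 := rfl

theorem mem_maximalIdeal_iff {φ : analyticGerms n} :
    φ ∈ IsLocalRing.maximalIdeal (analyticGerms n) ↔ germValue n φ = 0 := by
  rw [IsLocalRing.mem_maximalIdeal, mem_nonunits_iff, analyticGerms.isUnit_iff, not_not]
  rfl

theorem exists_analyticGerm_eq (φ : analyticGerms n) :
    ∃ (F : (Fin n → ℂ) → ℂ) (hF : AnalyticAt ℂ F 0), analyticGerm F hF = φ := by
  obtain ⟨_, F, hF, rfl⟩ := φ
  exact ⟨F, hF, rfl⟩

theorem analyticGerm_eq_iff {F G : (Fin n → ℂ) → ℂ} {hF : AnalyticAt ℂ F 0}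
    {hG : AnalyticAt ℂ G 0} : analyticGerm F hF = analyticGerm G hG ↔ F =ᶠ[𝓝 0] G :=
  Subtype.ext_iff.trans Filter.Germ.coe_eq

theorem analyticGerm_mul {F G : (Fin n → ℂ) → ℂ} (hF : AnalyticAt ℂ F 0) (hG : AnalyticAt ℂ G 0) :
    analyticGerm F hF * analyticGerm G hG = analyticGerm (fun x => F x * G x) (hF.fun_mul hG) := rfl

theorem analyticGerm_add {F G : (Fin n → ℂ) → ℂ} (hF : AnalyticAt ℂ F 0) (hG : AnalyticAt ℂ G 0) :
    analyticGerm F hF + analyticGerm G hG = analyticGerm (fun x => F x + G x) (hF.fun_add hG) := rfl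

theorem analyticGerm_sum {ι : Type*} (s : Finset ι) {F : ι → (Fin n → ℂ) → ℂ}
    (hF : ∀ i, AnalyticAt ℂ (F i) 0) :
    ∑ i ∈ s, analyticGerm (F i) (hF i) = analyticGerm (fun x => ∑ i ∈ s, F i x)
      (Finset.analyticAt_fun_sum _ fun i _ => hF i) := by
  classical
  induction s using Finset.induction_on with
  | empty => rfl
  | insert a s ha ih =>
    rw [Finset.sum_insert ha, ih, analyticGerm_add, analyticGerm_eq_iff]
    exact Eventually.of_forall fun x => (Finset.sum_insert (f := fun i => F i x) ha).symm

theorem analyticAt_coord (i : Fin n) : AnalyticAt ℂ (fun x : Fin n → ℂ => x i) 0 :=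
  (ContinuousLinearMap.proj (R := ℂ) (φ := fun _ : Fin n => ℂ) i).analyticAt 0

/-- The inclusion of polynomials into germs, as an algebra homomorphism. -/
noncomputable def polyGerm (n : ℕ) : MvPolynomial (Fin n) ℂ →ₐ[ℂ] analyticGerms n where
  toFun f := f.toAnalyticGerm
  map_one' := Subtype.ext <| Filter.Germ.coe_eq.mpr <|
    Eventually.of_forall fun x => map_one (MvPolynomial.eval x)
  map_zero' := Subtype.ext <| Filter.Germ.coe_eq.mpr <|
    Eventually.of_forall fun x => map_zero (MvPolynomial.eval x)
  map_mul' f g := Subtype.ext <| Filter.Germ.coe_eq.mpr <|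
    Eventually.of_forall fun x => map_mul (MvPolynomial.eval x) f g
  map_add' f g := Subtype.ext <| Filter.Germ.coe_eq.mpr <|
    Eventually.of_forall fun x => map_add (MvPolynomial.eval x) f g
  commutes' c := Subtype.ext <| Filter.Germ.coe_eq.mpr <|
    Eventually.of_forall fun _ => MvPolynomial.eval_C c

theorem polyGerm_apply (f : MvPolynomial (Fin n) ℂ) : polyGerm n f = f.toAnalyticGerm := rfl

theorem germValue_polyGerm (f : MvPolynomial (Fin n) ℂ) :
    germValue n (polyGerm n f) = MvPolynomial.eval 0 f := rfl

theorem germValue_algebraMap (c : ℂ) : germValue n (algebraMap ℂ (analyticGerms n) c) = c := rfl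

/-- The germ of the `i`-th coordinate. -/
noncomputable def coordGerm (i : Fin n) : analyticGerms n := polyGerm n (MvPolynomial.X i)

theorem coordGerm_eq (i : Fin n) :
    coordGerm i = analyticGerm (fun x => x i) (analyticAt_coord i) :=
  Subtype.ext <| Filter.Germ.coe_eq.mpr <| Eventually.of_forall fun _ => MvPolynomial.eval_X i

theorem germValue_coordGerm (i : Fin n) : germValue n (coordGerm i) = 0 := by
  rw [coordGerm_eq, germValue_analyticGerm, Pi.zero_apply]

theorem exists_eq_sum_coordGerm_mul {φ : analyticGerms n} (hφ : germValue n φ = 0) :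
    ∃ c : Fin n → analyticGerms n, φ = ∑ i, coordGerm i * c i := by
  obtain ⟨F, hF, rfl⟩ := exists_analyticGerm_eq φ
  obtain ⟨G, hG, h⟩ := hF.exists_eq_add_sum_mul
  rw [germValue_analyticGerm] at hφ
  refine ⟨fun i => analyticGerm (G i) (hG i), ?_⟩
  simp only [coordGerm_eq, analyticGerm_mul]
  rw [analyticGerm_sum Finset.univ fun i => (analyticAt_coord i).fun_mul (hG i),
    analyticGerm_eq_iff]
  filter_upwards [h] with x hx
  rw [hx, hφ, zero_add]

/-- Composition with an analytic map fixing the origin, as an endomorphism of `𝒪ₙ`. -/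
noncomputable def germPullback (Φ : (Fin n → ℂ) → (Fin n → ℂ)) (hΦ : AnalyticAt ℂ Φ 0)
    (h0 : Φ 0 = 0) : analyticGerms n →ₐ[ℂ] analyticGerms n where
  toFun φ := ⟨φ.1.compTendsto Φ (by simpa [ContinuousAt, h0] using hΦ.continuousAt), by
    obtain ⟨_, F, hF, rfl⟩ := φ
    exact ⟨F ∘ Φ, AnalyticAt.comp (by rwa [h0]) hΦ, rfl⟩⟩
  map_one' := rfl
  map_zero' := rfl
  map_mul' := by
    rintro ⟨_, F, hF, rfl⟩ ⟨_, G, hG, rfl⟩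
    rfl
  map_add' := by
    rintro ⟨_, F, hF, rfl⟩ ⟨_, G, hG, rfl⟩
    rfl
  commutes' _ := rfl

theorem germPullback_analyticGerm {Φ : (Fin n → ℂ) → (Fin n → ℂ)} (hΦ : AnalyticAt ℂ Φ 0)
    (h0 : Φ 0 = 0) {F : (Fin n → ℂ) → ℂ} (hF : AnalyticAt ℂ F 0) :
    germPullback Φ hΦ h0 (analyticGerm F hF) =
      analyticGerm (F ∘ Φ) (AnalyticAt.comp (by rwa [h0]) hΦ) := rfl

/-- Composition with a local analytic isomorphism is an automorphism of `𝒪ₙ`. -/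
theorem germPullback_bijective {Φ : (Fin n → ℂ) → (Fin n → ℂ)} (hΦ : AnalyticAt ℂ Φ 0)
    (h0 : Φ 0 = 0) {L : (Fin n → ℂ) →L[ℂ] (Fin n → ℂ)} (hL : HasFDerivAt Φ L 0)
    (hinj : ∀ v, L v = 0 → v = 0) : Function.Bijective (germPullback Φ hΦ h0) := by
  have hinj' : Function.Injective (L : (Fin n → ℂ) →ₗ[ℂ] (Fin n → ℂ)) :=
    (injective_iff_map_eq_zero _).mpr hinj
  let e : (Fin n → ℂ) ≃L[ℂ] (Fin n → ℂ) :=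
    (LinearEquiv.ofInjectiveEndo (L : (Fin n → ℂ) →ₗ[ℂ] (Fin n → ℂ)) hinj').toContinuousLinearEquiv
  have he : (e : (Fin n → ℂ) →L[ℂ] (Fin n → ℂ)) = L := by
    ext v
    rfl
  have hcd : ContDiffAt ℂ ⊤ Φ 0 := hΦ.contDiffAt
  have hL' : HasFDerivAt Φ (e : (Fin n → ℂ) →L[ℂ] (Fin n → ℂ)) 0 := by rwa [he]
  have htop : (⊤ : WithTop ℕ∞) ≠ 0 := by simp
  set Ψ := hcd.localInverse hL' htop with hΨdef
  have hΨ0 : Ψ 0 = 0 := by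
    have h := hcd.localInverse_apply_image hL' htop
    rwa [h0] at h
  have hΨ : AnalyticAt ℂ Ψ 0 := by
    have h := hcd.to_localInverse hL' htop
    rw [h0] at h
    exact h.analyticAt
  have hstrict := hcd.hasStrictFDerivAt' hL' htop
  have hleft : ∀ᶠ x in 𝓝 (0 : Fin n → ℂ), Ψ (Φ x) = x := hstrict.eventually_left_inverse
  have hright : ∀ᶠ x in 𝓝 (0 : Fin n → ℂ), Φ (Ψ x) = x := by
    have h := hstrict.eventually_right_inverse
    rwa [h0] at h
  have key : ∀ {Φ Ψ : (Fin n → ℂ) → (Fin n → ℂ)} (hΦ : AnalyticAt ℂ Φ 0) (h0 : Φ 0 = 0)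
      (hΨ : AnalyticAt ℂ Ψ 0) (hΨ0 : Ψ 0 = 0), (∀ᶠ x in 𝓝 (0 : Fin n → ℂ), Ψ (Φ x) = x) →
      ∀ φ, germPullback Φ hΦ h0 (germPullback Ψ hΨ hΨ0 φ) = φ := by
    intro Φ Ψ hΦ h0 hΨ hΨ0 h φ
    obtain ⟨F, hF, rfl⟩ := exists_analyticGerm_eq φ
    rw [germPullback_analyticGerm, germPullback_analyticGerm, analyticGerm_eq_iff]
    filter_upwards [h] with x hx
    simp [hx]
  exact Function.bijective_iff_has_inverse.mpr ⟨germPullback Ψ hΨ hΨ0,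
    key hΨ hΨ0 hΦ h0 hright, key hΦ h0 hΨ hΨ0 hleft⟩

/-- Substituting `x_i + ∑ j, x_j c_ij` for `x_i` is an automorphism of `𝒪ₙ` as soon as its linear
part `1 + c(0)` is injective. -/
theorem exists_algEquiv_coordGerm_add (c : Fin n → Fin n → analyticGerms n)
    (hc : ∀ v : Fin n → ℂ, (∀ i, v i + ∑ j, germValue n (c i j) * v j = 0) → v = 0) :
    ∃ φ : analyticGerms n ≃ₐ[ℂ] analyticGerms n,
      ∀ i, φ (coordGerm i) = coordGerm i + ∑ j, coordGerm j * c i j := by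
  choose C hC hCc using fun i j => exists_analyticGerm_eq (c i j)
  let Φ : (Fin n → ℂ) → (Fin n → ℂ) := fun x i => x i + ∑ j, x j * C i j x
  have hsum : ∀ i, AnalyticAt ℂ (fun x : Fin n → ℂ => ∑ j, x j * C i j x) 0 := fun i =>
    Finset.analyticAt_fun_sum _ fun j _ => (analyticAt_coord j).fun_mul (hC i j)
  have hΦi : ∀ i, AnalyticAt ℂ (fun x => Φ x i) 0 := fun i => (analyticAt_coord i).fun_add (hsum i)
  have hΦ : AnalyticAt ℂ Φ 0 := analyticAt_pi_iff.mpr hΦi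
  have h0 : Φ 0 = 0 := by
    ext i
    simp [Φ]
  let proj : Fin n → (Fin n → ℂ) →L[ℂ] ℂ := fun i =>
    ContinuousLinearMap.proj (R := ℂ) (φ := fun _ : Fin n => ℂ) i
  let L : (Fin n → ℂ) →L[ℂ] (Fin n → ℂ) :=
    ContinuousLinearMap.pi fun i => proj i + ∑ j, C i j 0 • proj j
  have hL : HasFDerivAt Φ L 0 := by
    refine hasFDerivAt_pi.mpr fun i => (proj i).hasFDerivAt.add (HasFDerivAt.fun_sum fun j _ => ?_)
    have h := (proj j).hasFDerivAt.fun_mul (hC i j).differentiableAt.hasFDerivAt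
    refine h.congr_fderiv (ContinuousLinearMap.ext fun v => ?_)
    change (0 : Fin n → ℂ) j * fderiv ℂ (C i j) 0 v + C i j 0 * v j = C i j 0 * v j
    rw [Pi.zero_apply, zero_mul, zero_add]
  have hinj : ∀ v, L v = 0 → v = 0 := fun v hv => hc v fun i => by
    have h := congrFun hv i
    simp only [← hCc, germValue_analyticGerm]
    simpa [L, proj] using h
  refine ⟨AlgEquiv.ofBijective (germPullback Φ hΦ h0) (germPullback_bijective hΦ h0 hL hinj),
    fun i => ?_⟩
  rw [AlgEquiv.coe_ofBijective]
  simp only [coordGerm_eq, ← hCc, analyticGerm_mul, germPullback_analyticGerm]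
  rw [analyticGerm_sum Finset.univ fun j => (analyticAt_coord j).fun_mul (hC i j),
    analyticGerm_add]
  rfl

end Germs

/-! ### The filtration by weighted order -/

section WeightFiltration

open MvPolynomial

variable {n : ℕ} {w : Fin n → ℕ}

variable (w) in
/-- The ideal of germs of weighted order at least `d`: it is generated by the monomials of weighted
degree at least `d`. -/
noncomputable def weightIdeal (d : ℕ) : Ideal (analyticGerms n) :=
  Ideal.span ((fun α => polyGerm n (monomial α 1)) '' {α | d ≤ Finsupp.weight w α})

theorem polyGerm_monomial_mem_weightIdeal {α : Fin n →₀ ℕ} {d : ℕ}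
    (h : d ≤ Finsupp.weight w α) : polyGerm n (monomial α 1) ∈ weightIdeal w d :=
  Ideal.subset_span ⟨α, h, rfl⟩

theorem weightIdeal_anti {d e : ℕ} (h : d ≤ e) : weightIdeal w e ≤ weightIdeal w d :=
  Ideal.span_mono (Set.image_mono fun _ hα => h.trans hα)

theorem mul_mem_weightIdeal {c d : ℕ} {u v : analyticGerms n} (hu : u ∈ weightIdeal w c)
    (hv : v ∈ weightIdeal w d) : u * v ∈ weightIdeal w (c + d) := by
  have h := Ideal.mul_mem_mul hu hv
  rw [weightIdeal, weightIdeal, Ideal.span_mul_span'] at h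
  refine Ideal.span_mono ?_ h
  rintro _ ⟨_, ⟨α, hα, rfl⟩, _, ⟨β, hβ, rfl⟩, rfl⟩
  refine ⟨α + β, ?_, ?_⟩
  · rw [Set.mem_ofPred_eq, map_add]
    exact add_le_add hα hβ
  · simp only
    rw [← map_mul, monomial_mul, one_mul]

theorem polyGerm_mem_weightIdeal {p : MvPolynomial (Fin n) ℂ} {c : ℕ}
    (hp : p.IsWeightedHomogeneous w c) : polyGerm n p ∈ weightIdeal w c := by
  rw [p.as_sum, map_sum]
  refine sum_mem fun α hα => ?_
  rw [← mul_one (coeff α p), ← C_mul_monomial, map_mul]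
  exact Ideal.mul_mem_left _ _
    (polyGerm_monomial_mem_weightIdeal (hp (mem_support_iff.mp hα)).ge)

theorem mem_weightIdeal_zero (u : analyticGerms n) : u ∈ weightIdeal w 0 := by
  have h := polyGerm_mem_weightIdeal (isWeightedHomogeneous_one ℂ w)
  rw [map_one] at h
  rw [(Ideal.eq_top_iff_one _).mpr h]
  exact Submodule.mem_top

theorem coordGerm_mem_weightIdeal (i : Fin n) : coordGerm i ∈ weightIdeal w (w i) :=
  polyGerm_mem_weightIdeal (isWeightedHomogeneous_X ℂ w i)

theorem mem_weightIdeal_one_of_germValue_eq_zero (hw : ∀ i, 0 < w i) {u : analyticGerms n}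
    (hu : germValue n u = 0) : u ∈ weightIdeal w 1 := by
  obtain ⟨c, rfl⟩ := exists_eq_sum_coordGerm_mul hu
  exact sum_mem fun i _ =>
    Ideal.mul_mem_right _ _ (weightIdeal_anti (hw i) (coordGerm_mem_weightIdeal i))

/-- A germ of weighted order at least `d ≥ 1` has no linear term in the variables of weight less
than `d`. -/
theorem exists_eq_sum_coordGerm_mul_of_mem_weightIdeal {d : ℕ} (hd : 0 < d) {u : analyticGerms n}
    (hu : u ∈ weightIdeal w d) :
    ∃ c : Fin n → analyticGerms n, u = ∑ j, coordGerm j * c j ∧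
      ∀ j, w j < d → germValue n (c j) = 0 := by
  refine Submodule.span_induction ?_ ?_ ?_ ?_ hu
  · rintro _ ⟨α, hα, rfl⟩
    have hα' : d ≤ Finsupp.weight w α := hα
    have hα0 : α ≠ 0 := by
      rintro rfl
      rw [map_zero] at hα'
      lia
    obtain ⟨i, hi⟩ := Finsupp.ne_iff.mp hα0
    have hsplit : Finsupp.single i 1 + (α - Finsupp.single i 1) = α :=
      add_tsub_cancel_of_le (Finsupp.single_le_iff.mpr (Nat.one_le_iff_ne_zero.mpr hi))
    refine ⟨Pi.single i (polyGerm n (monomial (α - Finsupp.single i 1) 1)), ?_, ?_⟩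
    · rw [Finset.sum_eq_single i (fun j _ hj => by rw [Pi.single_eq_of_ne hj, mul_zero])
        (fun h => absurd (Finset.mem_univ i) h), Pi.single_eq_same, coordGerm, ← map_mul, X,
        monomial_mul, hsplit, one_mul]
    · intro j hj
      rcases eq_or_ne j i with rfl | hji
      · rw [Pi.single_eq_same, germValue_polyGerm, eval_zero, constantCoeff_eq,
          coeff_monomial, if_neg]
        intro h0
        rw [h0, add_zero] at hsplit
        rw [← hsplit, Finsupp.weight_single, one_smul] at hα'
        lia
      · rw [Pi.single_eq_of_ne hji, map_zero]
  · exact ⟨0, by simp, by simp⟩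
  · rintro u v _ _ ⟨b, rfl, hb⟩ ⟨c, rfl, hc⟩
    refine ⟨b + c, by simp [mul_add, Finset.sum_add_distrib], fun j hj => ?_⟩
    rw [Pi.add_apply, map_add, hb j hj, hc j hj, add_zero]
  · rintro r u _ ⟨c, rfl, hc⟩
    refine ⟨fun j => r * c j, ?_, fun j hj => ?_⟩
    · rw [smul_eq_mul, Finset.mul_sum]
      exact Finset.sum_congr rfl fun j _ => by ring
    · rw [map_mul, hc j hj, mul_zero]

theorem germValue_eq_zero_of_mem_weightIdeal {d : ℕ} (hd : 0 < d) {u : analyticGerms n}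
    (hu : u ∈ weightIdeal w d) : germValue n u = 0 := by
  obtain ⟨c, rfl, -⟩ := exists_eq_sum_coordGerm_mul_of_mem_weightIdeal hd hu
  simp [germValue_coordGerm]

theorem maximalIdeal_pow_le_span (k : ℕ) :
    IsLocalRing.maximalIdeal (analyticGerms n) ^ k ≤
      Ideal.span ((fun α => polyGerm n (monomial α 1)) '' {α : Fin n →₀ ℕ | ∑ i, α i = k}) := by
  induction k with
  | zero =>
    have h1 : (1 : analyticGerms n) ∈ (fun α => polyGerm n (monomial α 1)) ''
        {α : Fin n →₀ ℕ | ∑ i, α i = 0} := ⟨0, by simp, map_one (polyGerm n)⟩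
    rw [(Ideal.eq_top_iff_one _).mpr (Ideal.subset_span h1)]
    exact le_top
  | succ k ih =>
    rw [pow_succ, Ideal.mul_le]
    intro u hu v hv
    obtain ⟨c, rfl⟩ := exists_eq_sum_coordGerm_mul (mem_maximalIdeal_iff.mp hv)
    rw [Finset.mul_sum]
    refine sum_mem fun i _ => ?_
    rw [← mul_assoc]
    refine Ideal.mul_mem_right _ _ ?_
    refine Submodule.span_induction ?_ ?_ ?_ ?_ (ih hu)
    · rintro _ ⟨α, hα, rfl⟩
      refine Ideal.subset_span ⟨α + Finsupp.single i 1, ?_, ?_⟩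
      · have hα' : ∑ j, α j = k := hα
        simp [Finset.sum_add_distrib, hα', Finsupp.single_apply]
      · simp only [coordGerm]
        rw [← map_mul, X, monomial_mul, one_mul]
    · rw [zero_mul]
      exact zero_mem _
    · intro u v _ _ hu hv
      rw [add_mul]
      exact add_mem hu hv
    · intro r u _ hu
      rw [smul_eq_mul, mul_assoc]
      exact Ideal.mul_mem_left _ _ hu

theorem maximalIdeal_pow_le_weightIdeal {k d : ℕ}
    (h : ∀ α : Fin n →₀ ℕ, ∑ i, α i = k → d ≤ Finsupp.weight w α) :
    IsLocalRing.maximalIdeal (analyticGerms n) ^ k ≤ weightIdeal w d :=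
  (maximalIdeal_pow_le_span k).trans (Ideal.span_mono (Set.image_mono fun α hα => h α hα))

/-- The linear term `∑ i, a i * ∂p/∂x_i` of the expansion of `p (x + a)`. -/
noncomputable def directionalDeriv (a : Fin n → analyticGerms n) (p : MvPolynomial (Fin n) ℂ) :
    analyticGerms n := ∑ i, a i * polyGerm n (pderiv i p)

theorem directionalDeriv_mul (a : Fin n → analyticGerms n) (p q : MvPolynomial (Fin n) ℂ) :
    directionalDeriv a (p * q) =
      polyGerm n p * directionalDeriv a q + polyGerm n q * directionalDeriv a p := by
  simp only [directionalDeriv, Finset.mul_sum, ← Finset.sum_add_distrib, Derivation.leibniz,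
    smul_eq_mul, map_add, map_mul]
  exact Finset.sum_congr rfl fun i _ => by ring

theorem directionalDeriv_X (a : Fin n → analyticGerms n) (i : Fin n) :
    directionalDeriv a (X i) = a i := by
  classical
  rw [directionalDeriv, Finset.sum_eq_single i]
  · rw [pderiv_X_self, map_one, mul_one]
  · intro j _ hj
    rw [pderiv_X_of_ne hj.symm, map_zero, mul_zero]
  · exact fun h => absurd (Finset.mem_univ i) h

theorem directionalDeriv_C (a : Fin n → analyticGerms n) (r : ℂ) :
    directionalDeriv a (C r) = 0 := by
  simp [directionalDeriv]

theorem directionalDeriv_add (a : Fin n → analyticGerms n) (p q : MvPolynomial (Fin n) ℂ) :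
    directionalDeriv a (p + q) = directionalDeriv a p + directionalDeriv a q := by
  simp only [directionalDeriv, map_add, mul_add, Finset.sum_add_distrib]

/-- The Taylor expansion of `p` at first order under a substitution `φ`, in terms of weighted
orders: `φ p = p + (linear term) + (remainder)`, the three terms being of weighted order at least
`c`, `c + e` and `c + 2 e`. -/
structure HasWeightedExpansion (w : Fin n → ℕ) (e : ℕ)
    (φ : analyticGerms n →ₐ[ℂ] analyticGerms n) (a : Fin n → analyticGerms n) (c : ℕ)
    (p : MvPolynomial (Fin n) ℂ) : Prop where
  mem : polyGerm n p ∈ weightIdeal w c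
  deriv_mem : directionalDeriv a p ∈ weightIdeal w (c + e)
  rem_mem : φ (polyGerm n p) - polyGerm n p - directionalDeriv a p ∈ weightIdeal w (c + 2 * e)

namespace HasWeightedExpansion

variable {e : ℕ} {φ : analyticGerms n →ₐ[ℂ] analyticGerms n} {a : Fin n → analyticGerms n}

theorem map_mem {c : ℕ} {p : MvPolynomial (Fin n) ℂ} (h : HasWeightedExpansion w e φ a c p) :
    φ (polyGerm n p) ∈ weightIdeal w c := by
  have : φ (polyGerm n p) = (φ (polyGerm n p) - polyGerm n p - directionalDeriv a p) +
      directionalDeriv a p + polyGerm n p := by ring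
  rw [this]
  exact add_mem (add_mem (weightIdeal_anti (by lia) h.rem_mem)
    (weightIdeal_anti (by lia) h.deriv_mem)) h.mem

theorem sub_mem {c : ℕ} {p : MvPolynomial (Fin n) ℂ} (h : HasWeightedExpansion w e φ a c p) :
    φ (polyGerm n p) - polyGerm n p ∈ weightIdeal w (c + e) := by
  have : φ (polyGerm n p) - polyGerm n p =
      (φ (polyGerm n p) - polyGerm n p - directionalDeriv a p) + directionalDeriv a p := by ring
  rw [this]
  exact add_mem (weightIdeal_anti (by lia) h.rem_mem) h.deriv_mem

theorem mul {c d : ℕ} {p q : MvPolynomial (Fin n) ℂ} (hp : HasWeightedExpansion w e φ a c p)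
    (hq : HasWeightedExpansion w e φ a d q) : HasWeightedExpansion w e φ a (c + d) (p * q) where
  mem := by
    rw [map_mul]
    exact mul_mem_weightIdeal hp.mem hq.mem
  deriv_mem := by
    rw [directionalDeriv_mul]
    exact add_mem (weightIdeal_anti (by lia) (mul_mem_weightIdeal hp.mem hq.deriv_mem))
      (weightIdeal_anti (by lia) (mul_mem_weightIdeal hq.mem hp.deriv_mem))
  rem_mem := by
    have h : φ (polyGerm n (p * q)) - polyGerm n (p * q) - directionalDeriv a (p * q) =
        polyGerm n p * (φ (polyGerm n q) - polyGerm n q - directionalDeriv a q) +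
        directionalDeriv a p * (φ (polyGerm n q) - polyGerm n q) +
        (φ (polyGerm n p) - polyGerm n p - directionalDeriv a p) * φ (polyGerm n q) := by
      rw [directionalDeriv_mul, map_mul, map_mul]
      ring
    rw [h]
    exact add_mem (add_mem (weightIdeal_anti (by lia) (mul_mem_weightIdeal hp.mem hq.rem_mem))
      (weightIdeal_anti (by lia) (mul_mem_weightIdeal hp.deriv_mem hq.sub_mem)))
      (weightIdeal_anti (by lia) (mul_mem_weightIdeal hp.rem_mem hq.map_mem))

theorem add {c : ℕ} {p q : MvPolynomial (Fin n) ℂ} (hp : HasWeightedExpansion w e φ a c p)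
    (hq : HasWeightedExpansion w e φ a c q) : HasWeightedExpansion w e φ a c (p + q) where
  mem := by
    rw [map_add]
    exact add_mem hp.mem hq.mem
  deriv_mem := by
    rw [directionalDeriv_add]
    exact add_mem hp.deriv_mem hq.deriv_mem
  rem_mem := by
    rw [directionalDeriv_add, map_add, map_add, add_sub_add_comm, add_sub_add_comm]
    exact add_mem hp.rem_mem hq.rem_mem

theorem C (r : ℂ) : HasWeightedExpansion w e φ a 0 (C r) where
  mem := mem_weightIdeal_zero _
  deriv_mem := by
    rw [directionalDeriv_C]
    exact zero_mem _
  rem_mem := by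
    rw [directionalDeriv_C, ← algebraMap_eq, AlgHom.commutes, AlgHom.commutes, sub_self, sub_zero]
    exact zero_mem _

theorem X (hφ : ∀ i, φ (coordGerm i) = coordGerm i + a i)
    (ha : ∀ i, a i ∈ weightIdeal w (w i + e)) (i : Fin n) :
    HasWeightedExpansion w e φ a (w i) (X i) where
  mem := coordGerm_mem_weightIdeal i
  deriv_mem := by
    rw [directionalDeriv_X]
    exact ha i
  rem_mem := by
    rw [directionalDeriv_X, ← coordGerm, hφ, add_sub_cancel_left, sub_self]
    exact zero_mem _

theorem monomial (hφ : ∀ i, φ (coordGerm i) = coordGerm i + a i)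
    (ha : ∀ i, a i ∈ weightIdeal w (w i + e)) (α : Fin n →₀ ℕ) :
    HasWeightedExpansion w e φ a (Finsupp.weight w α) (monomial α 1) := by
  induction α using Finsupp.induction_linear with
  | zero =>
    rw [map_zero]
    exact C 1
  | add α β hα hβ =>
    have h := hα.mul hβ
    rwa [monomial_mul, one_mul, ← map_add] at h
  | single i k =>
    induction k with
    | zero =>
      rw [Finsupp.single_zero, map_zero]
      exact C 1
    | succ k ih =>
      have h := ih.mul (X hφ ha i)
      rw [MvPolynomial.X, monomial_mul, one_mul, ← Finsupp.single_add] at h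
      rw [Finsupp.weight_single] at h ⊢
      rwa [add_smul, one_smul]

theorem of_isWeightedHomogeneous (hφ : ∀ i, φ (coordGerm i) = coordGerm i + a i)
    (ha : ∀ i, a i ∈ weightIdeal w (w i + e)) {c : ℕ} {p : MvPolynomial (Fin n) ℂ}
    (hp : p.IsWeightedHomogeneous w c) : HasWeightedExpansion w e φ a c p := by
  rw [p.as_sum]
  refine Finset.sum_induction _ (HasWeightedExpansion w e φ a c) (fun _ _ => add) ?_
    fun α hα => ?_
  · refine ⟨?_, ?_, ?_⟩ <;> simp [directionalDeriv]
  · have h := (C (coeff α p)).mul (monomial hφ ha α)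
    rwa [C_mul_monomial, mul_one, zero_add, hp (mem_support_iff.mp hα)] at h

end HasWeightedExpansion

/-- A substitution raising weighted orders changes a germ of weighted order at least `d` by a germ
of strictly larger weighted order. -/
theorem map_sub_self_mem_weightIdeal (hw : ∀ i, 0 < w i)
    {φ : analyticGerms n →ₐ[ℂ] analyticGerms n} {a : Fin n → analyticGerms n}
    (hφ : ∀ i, φ (coordGerm i) = coordGerm i + a i)
    (ha : ∀ i, a i ∈ weightIdeal w (w i + 1)) {d : ℕ} {u : analyticGerms n}
    (hu : u ∈ weightIdeal w d) : φ u - u ∈ weightIdeal w (d + 1) := by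
  -- Every germ `r` is a constant plus a combination of coordinates.
  have hone : ∀ r : analyticGerms n, φ r - r ∈ weightIdeal w 1 := by
    intro r
    have h0 : germValue n (r - algebraMap ℂ _ (germValue n r)) = 0 := by
      rw [map_sub, germValue_algebraMap, sub_self]
    obtain ⟨c, hc⟩ := exists_eq_sum_coordGerm_mul h0
    have hmem := mem_weightIdeal_one_of_germValue_eq_zero hw h0
    have hmap : φ (r - algebraMap ℂ _ (germValue n r)) ∈ weightIdeal w 1 := by
      rw [hc, map_sum]
      refine sum_mem fun i _ => ?_
      rw [map_mul, hφ]
      exact Ideal.mul_mem_right _ _ (add_mem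
        (weightIdeal_anti (hw i) (coordGerm_mem_weightIdeal i)) (weightIdeal_anti (by lia) (ha i)))
    have := Ideal.sub_mem _ hmap hmem
    rwa [map_sub, AlgHom.commutes, sub_sub_sub_cancel_right] at this
  refine Submodule.span_induction ?_ ?_ ?_ ?_ hu
  · rintro _ ⟨α, hα, rfl⟩
    exact weightIdeal_anti (Nat.add_le_add_right hα 1)
      (HasWeightedExpansion.monomial hφ ha α).sub_mem
  · rw [map_zero, sub_zero]
    exact zero_mem _
  · intro u v _ _ hu hv
    rw [map_add, add_sub_add_comm]
    exact add_mem hu hv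
  · intro r u hu' hu
    have h : φ (r • u) - r • u = φ r * (φ u - u) + u * (φ r - r) := by
      rw [smul_eq_mul, map_mul]
      ring
    rw [h]
    exact add_mem (Ideal.mul_mem_left _ _ hu) (mul_mem_weightIdeal hu' (hone r))

/-- Adding to each coordinate `x_i` a germ of weighted order larger than `w i` gives an automorphism:
its linear part is unipotent and triangular with respect to the weights. -/
theorem exists_algEquiv_of_mem_weightIdeal {a : Fin n → analyticGerms n}
    (ha : ∀ i, a i ∈ weightIdeal w (w i + 1)) :
    ∃ φ : analyticGerms n ≃ₐ[ℂ] analyticGerms n, ∀ i, φ (coordGerm i) = coordGerm i + a i := by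
  choose c hc hc0 using fun i =>
    exists_eq_sum_coordGerm_mul_of_mem_weightIdeal (Nat.succ_pos _) (ha i)
  obtain ⟨φ, hφ⟩ := exists_algEquiv_coordGerm_add c fun v hv => by
    by_contra hne
    obtain ⟨i₀, hi₀⟩ := Function.ne_iff.mp hne
    -- Look at a nonzero coordinate of `v` of largest weight.
    obtain ⟨i, hi, hmax⟩ := Finset.exists_max_image (Finset.univ.filter fun i => v i ≠ 0) w
      ⟨i₀, by simpa using hi₀⟩
    have hzero : ∑ j, germValue n (c i j) * v j = 0 := by
      refine Finset.sum_eq_zero fun j _ => ?_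
      by_cases hj : v j = 0
      · rw [hj, mul_zero]
      · rw [hc0 i j (Nat.lt_succ_of_le (hmax j (by simpa using hj))), zero_mul]
    have h := hv i
    rw [hzero, add_zero] at h
    exact (Finset.mem_filter.mp hi).2 h
  exact ⟨φ, fun i => by rw [hφ, ← hc]⟩

/-- One step of the normalisation: a perturbation `h` of `f` in the Jacobian ideal, of weighted order
`d > m`, can be replaced by one of weighted order at least `d + 1`. -/
theorem exists_algEquiv_add_eq_add (hw : ∀ i, 0 < w i) {m d : ℕ} (hmd : m < d)
    {f : MvPolynomial (Fin n) ℂ} (hf : f.IsWeightedHomogeneous w m) {a : Fin n → analyticGerms n}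
    (ha : ∀ i, a i ∈ weightIdeal w (w i + (d - m))) {h : analyticGerms n}
    (hh : h ∈ weightIdeal w d) (hsum : h = ∑ i, a i * polyGerm n (pderiv i f)) :
    ∃ φ : analyticGerms n ≃ₐ[ℂ] analyticGerms n, ∃ h' ∈ weightIdeal w (d + 1),
      φ (polyGerm n f + h) = polyGerm n f + h' := by
  have hna : ∀ i, -a i ∈ weightIdeal w (w i + (d - m)) := fun i => neg_mem (ha i)
  have hna1 : ∀ i, -a i ∈ weightIdeal w (w i + 1) := fun i =>
    weightIdeal_anti (by lia) (hna i)
  obtain ⟨φ, hφ⟩ := exists_algEquiv_of_mem_weightIdeal hna1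
  have hrem := (HasWeightedExpansion.of_isWeightedHomogeneous (φ := (φ : _ →ₐ[ℂ] _)) hφ hna
    hf).rem_mem
  have hmap := map_sub_self_mem_weightIdeal (φ := (φ : _ →ₐ[ℂ] _)) hw hφ hna1 hh
  have hderiv : directionalDeriv (fun i => -a i) f = -h := by
    rw [hsum, directionalDeriv, ← Finset.sum_neg_distrib]
    exact Finset.sum_congr rfl fun i _ => neg_mul _ _
  rw [hderiv] at hrem
  refine ⟨φ, _, add_mem (weightIdeal_anti (by lia) hrem) hmap, ?_⟩
  rw [map_add]
  change φ _ + φ h = _ + (φ _ - _ - -h + (φ h - h))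
  ring

end WeightFiltration

/-! ### Perturbations in `𝔪 J²` -/

section QuadraticPerturbation

open MvPolynomial

variable {n : ℕ}

/-- Second order Taylor expansion of a polynomial, with remainder in the square of the ideal of the
increments. -/
theorem MvPolynomial.exists_taylor_remainder (f : MvPolynomial (Fin n) ℂ) :
    ∃ G : Fin n → Fin n → (Fin n → ℂ) × (Fin n → ℂ) → ℂ, (∀ i j z, AnalyticAt ℂ (G i j) z) ∧
      ∀ x u : Fin n → ℂ, eval (x + u) f = eval x f + ∑ i, u i * eval x (pderiv i f) +
        ∑ i, ∑ j, u i * u j * G i j (x, u) := by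
  induction f using MvPolynomial.induction_on with
  | C a => exact ⟨fun _ _ _ => 0, fun _ _ _ => analyticAt_const, fun x u => by simp⟩
  | add p q hp hq =>
    obtain ⟨G, hG, hp⟩ := hp
    obtain ⟨H, hH, hq⟩ := hq
    refine ⟨fun i j z => G i j z + H i j z, fun i j z => (hG i j z).fun_add (hH i j z),
      fun x u => ?_⟩
    simp only [map_add, hp, hq, mul_add, Finset.sum_add_distrib]
    ring
  | mul_X p k hp =>
    obtain ⟨G, hG, hp⟩ := hp
    have hfst : ∀ (i : Fin n) z, AnalyticAt ℂ (fun z : (Fin n → ℂ) × (Fin n → ℂ) => z.1 i) z :=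
      fun i z => ((ContinuousLinearMap.proj (R := ℂ) (φ := fun _ : Fin n => ℂ) i).comp
        (ContinuousLinearMap.fst ℂ _ _)).analyticAt z
    have hsnd : ∀ (i : Fin n) z, AnalyticAt ℂ (fun z : (Fin n → ℂ) × (Fin n → ℂ) => z.2 i) z :=
      fun i z => ((ContinuousLinearMap.proj (R := ℂ) (φ := fun _ : Fin n => ℂ) i).comp
        (ContinuousLinearMap.snd ℂ _ _)).analyticAt z
    refine ⟨fun i j z => G i j z * (z.1 k + z.2 k) +
      (if i = k then 1 else 0) * eval z.1 (pderiv j p), fun i j z => ?_, fun x u => ?_⟩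
    · refine ((hG i j z).fun_mul ((hfst k z).fun_add (hsnd k z))).fun_add
        (analyticAt_const.fun_mul ?_)
      exact AnalyticAt.aeval_mvPolynomial (fun l => hfst l z) (pderiv j p)
    · have h1 : ∑ i, u i * eval x (pderiv i (p * X k)) =
          u k * eval x p + x k * ∑ i, u i * eval x (pderiv i p) := by
        simp only [Derivation.leibniz, pderiv_X, smul_eq_mul, map_add, map_mul, eval_X, mul_add,
          Finset.sum_add_distrib, Finset.mul_sum]
        congr 1
        · rw [Finset.sum_eq_single k]
          · simp
          · intro j _ hj
            simp [hj.symm]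
          · exact fun h => absurd (Finset.mem_univ k) h
        · exact Finset.sum_congr rfl fun i _ => by ring
      have h2 : ∑ i, ∑ j, u i * u j * (G i j (x, u) * (x k + u k) +
          (if i = k then 1 else 0) * eval x (pderiv j p)) =
          (∑ i, ∑ j, u i * u j * G i j (x, u)) * (x k + u k) +
            u k * ∑ j, u j * eval x (pderiv j p) := by
        simp only [mul_add, Finset.sum_add_distrib, Finset.sum_mul]
        congr 1
        · simp only [← Finset.sum_add_distrib]
          exact Finset.sum_congr rfl fun i _ => Finset.sum_congr rfl fun j _ => by ring
        · rw [Finset.sum_eq_single k]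
          · rw [Finset.mul_sum]
            exact Finset.sum_congr rfl fun j _ => by rw [if_pos rfl]; ring
          · intro j _ hj
            simp [hj]
          · exact fun h => absurd (Finset.mem_univ k) h
      rw [h1, h2, map_mul, eval_X, hp, map_mul, eval_X, Pi.add_apply]
      ring

/-- The identity between quadratic forms in `g` that turns the equation
`y + yᵀ G y = B` into a solution of the perturbation problem. -/
theorem sum_quadratic_eq {R : Type*} [CommRing R] {B G : Fin n → Fin n → R} {y : Fin n × Fin n → R}
    (hy : ∀ i j, y (i, j) + ∑ p, ∑ l, y (p, i) * (y (l, j) * G p l) = B i j) (g : Fin n → R) :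
    ∑ i, (∑ j, y (i, j) * g j) * g i +
      ∑ p, ∑ l, (∑ i, y (p, i) * g i) * (∑ j, y (l, j) * g j) * G p l =
      ∑ i, ∑ j, B i j * g i * g j := by
  have h1 : ∑ p, ∑ l, (∑ i, y (p, i) * g i) * (∑ j, y (l, j) * g j) * G p l =
      ∑ i, ∑ j, (∑ p, ∑ l, y (p, i) * (y (l, j) * G p l)) * g i * g j := by
    simp only [Finset.sum_mul_sum]
    simp only [Finset.sum_mul]
    rw [Finset.sum_congr rfl fun p _ => Finset.sum_comm, Finset.sum_comm]
    refine Finset.sum_congr rfl fun i _ => ?_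
    rw [Finset.sum_congr rfl fun p _ => Finset.sum_comm, Finset.sum_comm]
    exact Finset.sum_congr rfl fun j _ => Finset.sum_congr rfl fun p _ =>
      Finset.sum_congr rfl fun l _ => by ring
  rw [h1, ← Finset.sum_add_distrib]
  refine Finset.sum_congr rfl fun i _ => ?_
  rw [Finset.sum_mul, ← Finset.sum_add_distrib]
  refine Finset.sum_congr rfl fun j _ => ?_
  rw [← hy i j]
  ring

/-- Solution of `f (x + y(x) ∇f(x)) = f(x) + ∑ B i j ∂ᵢf ∂ⱼf` by the implicit function theorem
applied to the matrix-valued unknown `y`. -/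
theorem exists_analyticAt_eval_add_eq (f : MvPolynomial (Fin n) ℂ)
    {B : Fin n → Fin n → (Fin n → ℂ) → ℂ} (hB : ∀ i j, AnalyticAt ℂ (B i j) 0)
    (hB0 : ∀ i j, B i j 0 = 0) :
    ∃ Y : Fin n → Fin n → (Fin n → ℂ) → ℂ, (∀ i j, AnalyticAt ℂ (Y i j) 0) ∧
      (∀ i j, Y i j 0 = 0) ∧ ∀ᶠ x in 𝓝 (0 : Fin n → ℂ),
        eval (fun i => x i + ∑ j, Y i j x * eval x (pderiv j f)) f =
          eval x f + ∑ i, ∑ j, B i j x * eval x (pderiv i f) * eval x (pderiv j f) := by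
  obtain ⟨G, hG, hf⟩ := f.exists_taylor_remainder
  let g : Fin n → (Fin n → ℂ) → ℂ := fun j x => eval x (pderiv j f)
  have hg : ∀ j x, AnalyticAt ℂ (g j) x := fun j x =>
    AnalyticOnNhd.eval_mvPolynomial (pderiv j f) x trivial
  let proj : Fin n × Fin n → (Fin n × Fin n → ℂ) →L[ℂ] ℂ := fun i =>
    ContinuousLinearMap.proj (R := ℂ) (φ := fun _ : Fin n × Fin n => ℂ) i
  let U : (Fin n → ℂ) × (Fin n × Fin n → ℂ) → (Fin n → ℂ) := fun z i =>
    ∑ j, z.2 (i, j) * g j z.1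
  let Ψ : (Fin n → ℂ) × (Fin n × Fin n → ℂ) → (Fin n × Fin n → ℂ) := fun z a =>
    z.2 a + ∑ p, ∑ l, z.2 (p, a.1) * (z.2 (l, a.2) * G p l (z.1, U z)) - B a.1 a.2 z.1
  have hfst : ∀ z, AnalyticAt ℂ (fun z : (Fin n → ℂ) × (Fin n × Fin n → ℂ) => z.1) z := fun z =>
    analyticAt_fst
  have hsnd : ∀ a z, AnalyticAt ℂ (fun z : (Fin n → ℂ) × (Fin n × Fin n → ℂ) => z.2 a) z :=
    fun a z => ((proj a).comp (ContinuousLinearMap.snd ℂ _ _)).analyticAt z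
  have hU : ∀ z, AnalyticAt ℂ U z := fun z => analyticAt_pi_iff.mpr fun i =>
    Finset.analyticAt_fun_sum _ fun j _ => (hsnd (i, j) z).fun_mul ((hg j z.1).comp (hfst z))
  have hGU : ∀ p l z, AnalyticAt ℂ (fun z => G p l (z.1, U z)) z := fun p l z =>
    (hG p l _).comp ((hfst z).prod (hU z))
  have hΨ : AnalyticAt ℂ Ψ (0, 0) := analyticAt_pi_iff.mpr fun a => by
    refine ((hsnd a _).fun_add (Finset.analyticAt_fun_sum _ fun p _ =>
      Finset.analyticAt_fun_sum _ fun l _ => ?_)).fun_sub (AnalyticAt.comp (hB a.1 a.2) (hfst _))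
    exact (hsnd _ _).fun_mul ((hsnd _ _).fun_mul (hGU p l _))
  have hΨ0 : Ψ (0, 0) = 0 := by
    ext a
    simp [Ψ, hB0]
  -- The partial derivative in `y` at the origin is the identity, the other terms being quadratic.
  have hpartial : HasFDerivAt (fun y => Ψ (0, y)) (ContinuousLinearMap.id ℂ _) 0 := by
    refine hasFDerivAt_pi'.mpr fun a => ?_
    have hquad : ∀ p l, HasFDerivAt (fun y : Fin n × Fin n → ℂ =>
        y (p, a.1) * (y (l, a.2) * G p l (0, U (0, y)))) (0 : (Fin n × Fin n → ℂ) →L[ℂ] ℂ) 0 := by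
      intro p l
      have hd : DifferentiableAt ℂ (fun y : Fin n × Fin n → ℂ =>
          y (l, a.2) * G p l (0, U (0, y))) 0 := by
        refine DifferentiableAt.fun_mul (proj (l, a.2)).differentiableAt ?_
        have h := (hGU p l ((0 : Fin n → ℂ), (0 : Fin n × Fin n → ℂ))).comp
          (f := fun y : Fin n × Fin n → ℂ => ((0 : Fin n → ℂ), y)) (x := 0)
          (analyticAt_const.prod analyticAt_id)
        exact h.differentiableAt
      have h := (proj (p, a.1)).hasFDerivAt.fun_mul hd.hasFDerivAt
      refine h.congr_fderiv (ContinuousLinearMap.ext fun v => ?_)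
      change (0 : Fin n × Fin n → ℂ) (p, a.1) * _ +
        ((0 : Fin n × Fin n → ℂ) (l, a.2) * _) * v (p, a.1) = 0
      rw [Pi.zero_apply, Pi.zero_apply, zero_mul, zero_mul, zero_mul, add_zero]
    have h := ((proj a).hasFDerivAt (x := 0)).fun_add (HasFDerivAt.fun_sum (u := Finset.univ)
      fun p _ => HasFDerivAt.fun_sum (u := Finset.univ) fun l _ => hquad p l)
    have h' := h.sub_const (B a.1 a.2 0)
    refine h'.congr_fderiv (ContinuousLinearMap.ext fun v => ?_)
    simp [proj]
  have hcd : ContDiffAt ℂ ⊤ Ψ (0, 0) := hΨ.contDiffAt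
  have htop : (⊤ : WithTop ℕ∞) ≠ 0 := by simp
  have hinr : fderiv ℂ Ψ (0, 0) ∘L .inr ℂ (Fin n → ℂ) (Fin n × Fin n → ℂ) =
      ContinuousLinearMap.id ℂ _ := by
    have h1 : HasFDerivAt (fun y : Fin n × Fin n → ℂ => ((0 : Fin n → ℂ), y))
        (ContinuousLinearMap.inr ℂ (Fin n → ℂ) (Fin n × Fin n → ℂ)) 0 :=
      (ContinuousLinearMap.inr ℂ (Fin n → ℂ) (Fin n × Fin n → ℂ)).hasFDerivAt
    exact (HasFDerivAt.comp (0 : Fin n × Fin n → ℂ) (g := Ψ)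
      hΨ.differentiableAt.hasFDerivAt h1).unique hpartial
  have hinv : (fderiv ℂ Ψ (0, 0) ∘L .inr ℂ (Fin n → ℂ) (Fin n × Fin n → ℂ)).IsInvertible := by
    rw [hinr]
    exact ⟨ContinuousLinearEquiv.refl ℂ _, rfl⟩
  let y := hcd.implicitFunction htop hinv
  have hy0 : y 0 = 0 := hcd.implicitFunction_apply_self htop hinv
  have hyan : AnalyticAt ℂ y 0 := (hcd.contDiffAt_implicitFunction htop hinv).analyticAt
  have hyeq : ∀ᶠ x in 𝓝 (0 : Fin n → ℂ), Ψ (x, y x) = 0 := by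
    have h := hcd.eventually_apply_implicitFunction htop hinv
    rwa [hΨ0] at h
  refine ⟨fun i j x => y x (i, j), fun i j => analyticAt_pi_iff.mp hyan (i, j),
    fun i j => congrFun hy0 (i, j), ?_⟩
  filter_upwards [hyeq] with x hx
  have hsol : ∀ i j, y x (i, j) +
      ∑ p, ∑ l, y x (p, i) * (y x (l, j) * G p l (x, U (x, y x))) = B i j x := fun i j => by
    have h := congrFun hx (i, j)
    exact sub_eq_zero.mp h
  have h := sum_quadratic_eq hsol fun j => g j x
  have ht := hf x (U (x, y x))
  rw [add_assoc] at ht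
  exact ht.trans (congrArg (eval x f + ·) h)

theorem analyticAt_eval {V : Fin n → (Fin n → ℂ) → ℂ} (hV : ∀ i, AnalyticAt ℂ (V i) 0)
    (f : MvPolynomial (Fin n) ℂ) : AnalyticAt ℂ (fun x => eval (fun i => V i x) f) 0 :=
  AnalyticAt.aeval_mvPolynomial hV f

theorem algHom_polyGerm {φ : analyticGerms n →ₐ[ℂ] analyticGerms n}
    {V : Fin n → (Fin n → ℂ) → ℂ} (hV : ∀ i, AnalyticAt ℂ (V i) 0)
    (hφ : ∀ i, φ (coordGerm i) = analyticGerm (V i) (hV i)) (f : MvPolynomial (Fin n) ℂ) :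
    φ (polyGerm n f) = analyticGerm (fun x => eval (fun i => V i x) f) (analyticAt_eval hV f) := by
  induction f using MvPolynomial.induction_on with
  | C a =>
    rw [← algebraMap_eq, AlgHom.commutes, AlgHom.commutes]
    exact (analyticGerm_eq_iff (hF := analyticAt_const)).mpr
      (Eventually.of_forall fun x => (eval_C a).symm)
  | add p q hp hq =>
    rw [map_add, map_add, hp, hq, analyticGerm_add, analyticGerm_eq_iff]
    exact Eventually.of_forall fun x => (map_add (eval fun i => V i x) p q).symm
  | mul_X p i hp =>
    rw [map_mul, map_mul, hp, ← coordGerm, hφ, analyticGerm_mul, analyticGerm_eq_iff]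
    refine Eventually.of_forall fun x => ?_
    simp only [map_mul, eval_X]

/-- A perturbation of `f` lying in `𝔪 J²`, where `J` is the Jacobian ideal of `f`, does not change
the right equivalence class of `f`. -/
theorem exists_algEquiv_polyGerm_eq_add (f : MvPolynomial (Fin n) ℂ)
    (hgrad : ∀ j, eval 0 (pderiv j f) = 0) (b : Fin n → Fin n → analyticGerms n)
    (hb : ∀ i j, germValue n (b i j) = 0) :
    ∃ φ : analyticGerms n ≃ₐ[ℂ] analyticGerms n, φ (polyGerm n f) = polyGerm n f +
      ∑ i, ∑ j, b i j * polyGerm n (pderiv i f) * polyGerm n (pderiv j f) := by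
  choose B hB hBb using fun i j => exists_analyticGerm_eq (b i j)
  obtain ⟨Y, hY, hY0, hYf⟩ := exists_analyticAt_eval_add_eq f hB fun i j => by
    rw [← hb i j, ← hBb, germValue_analyticGerm]
  have hpd : ∀ j, AnalyticAt ℂ (fun x => eval x (pderiv j f)) 0 := fun j =>
    AnalyticOnNhd.eval_mvPolynomial (pderiv j f) 0 trivial
  have hpoly : ∀ p : MvPolynomial (Fin n) ℂ, polyGerm n p =
      analyticGerm (fun x => eval x p) (AnalyticOnNhd.eval_mvPolynomial p 0 trivial) := fun p => rfl
  -- The substitution `x_i + ∑ j, Y i j ∂ⱼf` has the identity as linear part.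
  choose z hz using fun i j => exists_eq_sum_coordGerm_mul
    (φ := analyticGerm (Y i j) (hY i j)) (hY0 i j)
  have hval : ∀ i l, germValue n (∑ j, z i j l * polyGerm n (pderiv j f)) = 0 := fun i l => by
    rw [map_sum]
    exact Finset.sum_eq_zero fun j _ => by rw [map_mul, germValue_polyGerm, hgrad, mul_zero]
  obtain ⟨φ, hφ⟩ := exists_algEquiv_coordGerm_add
    (fun i l => ∑ j, z i j l * polyGerm n (pderiv j f)) fun v hv => by
      ext i
      simpa [hval] using hv i
  have hterm : ∀ i j, AnalyticAt ℂ (fun x => Y i j x * eval x (pderiv j f)) 0 := fun i j =>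
    (hY i j).fun_mul (hpd j)
  have hφ' : ∀ i, φ (coordGerm i) = analyticGerm
      (fun x => x i + ∑ j, Y i j x * eval x (pderiv j f))
      ((analyticAt_coord i).fun_add (Finset.analyticAt_fun_sum _ fun j _ => hterm i j)) := by
    intro i
    have hswap : ∑ l, coordGerm l * ∑ j, z i j l * polyGerm n (pderiv j f) =
        ∑ j, analyticGerm (Y i j) (hY i j) * polyGerm n (pderiv j f) := by
      simp only [hz, Finset.mul_sum, Finset.sum_mul]
      rw [Finset.sum_comm]
      exact Finset.sum_congr rfl fun j _ => Finset.sum_congr rfl fun l _ => by ring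
    rw [hφ, hswap, coordGerm_eq]
    simp only [hpoly, analyticGerm_mul]
    rw [analyticGerm_sum Finset.univ (hterm i), analyticGerm_add]
  refine ⟨φ, ?_⟩
  have hmain := algHom_polyGerm (φ := (φ : analyticGerms n →ₐ[ℂ] analyticGerms n)) _ hφ' f
  have hBterm : ∀ i j, AnalyticAt ℂ
      (fun x => B i j x * eval x (pderiv i f) * eval x (pderiv j f)) 0 := fun i j =>
    ((hB i j).fun_mul (hpd i)).fun_mul (hpd j)
  simp only [← hBb, hpoly, analyticGerm_mul]
  rw [Finset.sum_congr rfl fun i _ => analyticGerm_sum Finset.univ (hBterm i),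
    analyticGerm_sum Finset.univ fun i => Finset.analyticAt_fun_sum _ fun j _ => hBterm i j,
    analyticGerm_add]
  exact hmain.trans (analyticGerm_eq_iff.mpr hYf)

end QuadraticPerturbation

/-! ### Determinacy -/

section Determinacy

open MvPolynomial

variable {n m : ℕ} {w : Fin n → ℕ} {f : MvPolynomial (Fin n) ℂ}

theorem IsRegularPolynomial.pderiv_ne_zero (hreg : IsRegularPolynomial f) (i : Fin n) :
    pderiv i f ≠ 0 := by
  intro h0
  have hlen : i.1 < (List.ofFn fun i : Fin n => pderiv i f).length := by simp
  have hr := hreg.regular_mod_prev i.1 hlen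
  have hgi : (List.ofFn fun i : Fin n => pderiv i f)[i.1] = 0 := by simp [h0]
  rw [hgi] at hr
  have htop : Ideal.ofList ((List.ofFn fun i : Fin n => pderiv i f).take i.1) • ⊤ =
      (⊤ : Submodule (MvPolynomial (Fin n) ℂ) (MvPolynomial (Fin n) ℂ)) := by
    rw [← Submodule.Quotient.subsingleton_iff]
    exact ⟨fun a b => hr (by simp only [zero_smul])⟩
  refine hreg.top_ne_smul (top_unique ?_).symm
  conv_lhs => rw [← htop]
  exact Submodule.smul_mono_left (Ideal.span_mono fun r hr => List.mem_of_mem_take hr)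

theorem IsRegularPolynomial.weight_lt (hw : ∀ i, 0 < w i) (hf : f.IsWeightedHomogeneous w m)
    (hreg : IsRegularPolynomial f) (i : Fin n) : w i < m := by
  obtain ⟨α, hα⟩ := ne_zero_iff.mp (hreg.pderiv_ne_zero i)
  rw [coeff_pderiv] at hα
  have hwt := hf (left_ne_zero_of_mul hα)
  rw [map_add, Finsupp.weight_single, one_smul] at hwt
  refine lt_of_le_of_ne (by lia) fun heq => ?_
  -- A partial derivative of weight zero would be a nonzero constant.
  have h0 : (pderiv i f).IsWeightedHomogeneous w 0 := hf.pderiv (by rw [zero_add, heq])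
  have hC : pderiv i f = C (coeff 0 (pderiv i f)) := by
    ext β
    rw [coeff_C]
    split_ifs with hβ
    · rw [hβ]
    · refine h0.coeff_eq_zero β fun hzero => hβ ?_
      ext j
      have := Finsupp.le_weight w (hw j).ne' β
      rw [Finsupp.zero_apply]
      lia
  have hne : coeff 0 (pderiv i f) ≠ 0 := fun hz =>
    hreg.pderiv_ne_zero i (by rw [hC, hz, map_zero])
  have hunit : IsUnit (pderiv i f) := by
    rw [hC]
    exact (isUnit_iff_ne_zero.mpr hne).map C
  refine hreg.top_ne_smul ?_
  have hmem : pderiv i f ∈ Ideal.ofList (List.ofFn fun i : Fin n => pderiv i f) :=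
    Ideal.subset_span (by simp)
  rw [Ideal.eq_top_of_isUnit_mem _ hmem hunit, Submodule.top_smul]

/-- Germs of weighted order above `∑ (m - w i) - ∑ w i` lie in the Jacobian ideal, with control on
the weighted orders of the coefficients. -/
theorem exists_eq_sum_mul_pderiv (hw : ∀ i, 0 < w i) (hf : f.IsWeightedHomogeneous w m)
    (hreg : IsRegularPolynomial f) {d : ℕ} (hd : ∑ i, (m - w i) < d + ∑ i, w i) (hmd : m ≤ d)
    {h : analyticGerms n} (hh : h ∈ weightIdeal w d) :
    ∃ a : Fin n → analyticGerms n, (∀ i, a i ∈ weightIdeal w (w i + (d - m))) ∧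
      h = ∑ i, a i * polyGerm n (pderiv i f) := by
  have hlt := hreg.weight_lt hw hf
  have hpd : ∀ i, (pderiv i f).IsWeightedHomogeneous w (m - w i) := fun i =>
    hf.pderiv (Nat.sub_add_cancel (hlt i).le)
  refine Submodule.span_induction ?_ ?_ ?_ ?_ hh
  · rintro _ ⟨α, hα, rfl⟩
    have hα' : d ≤ Finsupp.weight w α := hα
    have hmon := isWeightedHomogeneous_monomial w α (1 : ℂ) rfl
    have hmem := mem_span_range_of_isWeightedHomogeneous hw hpd hreg.pderiv_ne_zero
      hreg.toIsWeaklyRegular (hd.trans_le (Nat.add_le_add_right hα' _)) hmon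
    obtain ⟨b, hb, hsum⟩ := exists_eq_sum_mul_isWeightedHomogeneous hpd hmon hmem
      fun i => by lia
    refine ⟨fun i => polyGerm n (b i), fun i => ?_, ?_⟩
    · have := hlt i
      exact weightIdeal_anti (by lia) (polyGerm_mem_weightIdeal (hb i))
    · simp only
      conv_lhs => rw [hsum]
      simp only [map_sum, map_mul]
  · exact ⟨0, fun i => zero_mem _, by simp⟩
  · rintro u v _ _ ⟨a, ha, rfl⟩ ⟨b, hb, rfl⟩
    exact ⟨a + b, fun i => add_mem (ha i) (hb i), by simp [add_mul, Finset.sum_add_distrib]⟩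
  · rintro r u _ ⟨a, ha, rfl⟩
    refine ⟨fun i => r * a i, fun i => Ideal.mul_mem_left _ _ (ha i), ?_⟩
    simp [Finset.mul_sum, mul_assoc]

/-- Perturbations of weighted order above both `m` and the socle degree of the Jacobian algebra do
not change the right equivalence class of `f`. -/
theorem exists_algEquiv_polyGerm_eq_add_of_mem_weightIdeal (hw : ∀ i, 0 < w i)
    (hf : f.IsWeightedHomogeneous w m) (hreg : IsRegularPolynomial f) {d : ℕ}
    (hd : ∑ i, (m - w i) < d + ∑ i, w i) (hmd : m < d) {h : analyticGerms n}
    (hh : h ∈ weightIdeal w d) :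
    ∃ φ : analyticGerms n ≃ₐ[ℂ] analyticGerms n, φ (polyGerm n f) = polyGerm n f + h := by
  have hlt := hreg.weight_lt hw hf
  -- Raise the weighted order of the perturbation arbitrarily.
  have hraise : ∀ t, ∃ φ : analyticGerms n ≃ₐ[ℂ] analyticGerms n, ∃ h' ∈ weightIdeal w (d + t),
      φ (polyGerm n f + h) = polyGerm n f + h' := by
    intro t
    induction t with
    | zero => exact ⟨AlgEquiv.refl, h, hh, rfl⟩
    | succ t ih =>
      obtain ⟨φ, h', hh', hφ⟩ := ih
      obtain ⟨a, ha, hsum⟩ := exists_eq_sum_mul_pderiv hw hf hreg (by lia) (by lia) hh'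
      obtain ⟨ψ, h'', hh'', hψ⟩ := exists_algEquiv_add_eq_add hw (by lia) hf ha hh' hsum
      exact ⟨φ.trans ψ, h'', hh'', by rw [AlgEquiv.trans_apply, hφ, hψ]⟩
  -- A perturbation of order at least `d + m` has coefficients `a i` of order above `d`, hence lies
  -- in `𝔪 J²`.
  obtain ⟨φ, h', hh', hφ⟩ := hraise m
  obtain ⟨a, ha, hsum⟩ := exists_eq_sum_mul_pderiv hw hf hreg (by lia) (by lia) hh'
  choose b hb hbsum using fun i => exists_eq_sum_mul_pderiv hw hf hreg hd hmd.le
    (weightIdeal_anti (by lia) (ha i))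
  have hgrad : ∀ j, eval 0 (pderiv j f) = 0 := fun j => by
    rw [← germValue_polyGerm]
    exact germValue_eq_zero_of_mem_weightIdeal (Nat.sub_pos_of_lt (hlt j))
      (polyGerm_mem_weightIdeal (hf.pderiv (Nat.sub_add_cancel (hlt j).le)))
  obtain ⟨ψ, hψ⟩ := exists_algEquiv_polyGerm_eq_add f hgrad (fun i j => b i j) fun i j =>
    germValue_eq_zero_of_mem_weightIdeal (by have := hw j; lia) (hb i j)
  refine ⟨ψ.trans φ.symm, ?_⟩
  rw [AlgEquiv.trans_apply, AlgEquiv.symm_apply_eq, hφ, hψ, hsum]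
  congr 1
  refine Finset.sum_congr rfl fun i _ => ?_
  rw [hbsum i, Finset.sum_mul]
  exact Finset.sum_congr rfl fun j _ => mul_right_comm _ _ _

end Determinacy

theorem theorem4p1 (n m : ℕ) (w : Fin n → ℕ) (hw : ∀ i, 0 < w i)
    (f : MvPolynomial (Fin n) ℂ) (hf : f.IsWeightedHomogeneous w m)
    (hreg : IsRegularPolynomial f)
    (hm : ∀ i, (m : ℤ) < ((n : ℤ) * m - 2 * ∑ j, (w j : ℤ) + 1) * w i) :
    ∃ k : ℕ, (k : ℤ) = (n : ℤ) * m - 2 * ∑ j, (w j : ℤ) ∧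
      IsDetermined k f.toAnalyticGerm := by
  have hk0 : 0 ≤ (n : ℤ) * m - 2 * ∑ j, (w j : ℤ) := by
    rcases n.eq_zero_or_pos with rfl | hn
    · simp
    · have h := hm ⟨0, hn⟩
      have := pos_of_mul_pos_left ((Int.natCast_nonneg m).trans_lt h)
        (Int.natCast_nonneg (w ⟨0, hn⟩))
      lia
  obtain ⟨k, hk⟩ := Int.eq_ofNat_of_zero_le hk0
  refine ⟨k, hk.symm, fun g hg => ?_⟩
  rw [hk] at hm
  have hlt := hreg.weight_lt hw hf
  have hsum : ∑ i, (m - w i) + ∑ i, w i = n * m := by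
    rw [← Finset.sum_add_distrib, Finset.sum_congr rfl fun i _ => Nat.sub_add_cancel (hlt i).le]
    simp
  have hdeg : ∑ i, (m - w i) = k + ∑ i, w i := by
    zify at hsum ⊢
    lia
  have hmem : g - f.toAnalyticGerm ∈ weightIdeal w (max k m + 1) := by
    have h : g - f.toAnalyticGerm ∈ IsLocalRing.maximalIdeal (analyticGerms n) ^ (k + 1) :=
      Ideal.Quotient.eq.mp hg.symm
    refine maximalIdeal_pow_le_weightIdeal (fun α hα => ?_) h
    have hwt : Finsupp.weight w α = ∑ i, α i * w i := by
      simp [Finsupp.weight_apply, Finsupp.sum_fintype]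
    have h1 : k + 1 ≤ Finsupp.weight w α := by
      rw [hwt, ← hα]
      exact Finset.sum_le_sum fun i _ => Nat.le_mul_of_pos_right _ (hw i)
    have h2 : m < Finsupp.weight w α := by
      have hm' : ∀ i, m < (k + 1) * w i := fun i => by exact_mod_cast hm i
      obtain ⟨i, -, hi⟩ : ∃ i ∈ Finset.univ, α i ≠ 0 :=
        Finset.exists_ne_zero_of_sum_ne_zero (by rw [hα]; exact Nat.succ_ne_zero k)
      have hlt : ∑ i, α i * m < ∑ i, α i * ((k + 1) * w i) :=
        Finset.sum_lt_sum (fun j _ => Nat.mul_le_mul_left _ (hm' j).le)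
          ⟨i, Finset.mem_univ i, Nat.mul_lt_mul_of_pos_left (hm' i) (Nat.pos_of_ne_zero hi)⟩
      have hrhs : ∑ i, α i * ((k + 1) * w i) = (k + 1) * Finsupp.weight w α := by
        rw [hwt, Finset.mul_sum]
        exact Finset.sum_congr rfl fun i _ => Nat.mul_left_comm _ _ _
      rw [hrhs, ← Finset.sum_mul, hα] at hlt
      exact Nat.lt_of_mul_lt_mul_left hlt
    lia
  obtain ⟨φ, hφ⟩ := exists_algEquiv_polyGerm_eq_add_of_mem_weightIdeal hw hf hreg
    (by lia) (by lia) hmem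
  exact ⟨φ, by rw [← polyGerm_apply, hφ, polyGerm_apply, add_sub_cancel]⟩
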